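/- Let $d\ge 5$ and $2\le r\le d-3$ be integers, let $X=\{x_1,\dots,x_d\}$ be a set with $d$ elements, and let $\Omega_\ell=\mathrm{Alt}(X^\ell)\cong\mathrm{Alt}(d^\ell)$ be the alternating group on the set of words of length $\ell\ge 1$ over $X$. For $\ell\le k$ let $\iota_{\ell,k}\colon\Omega_\ell\to\Omega_k$ be given by $\iota_{\ell,k}(\sigma)(vw)=\sigma(v)w$ for $v\in X^\ell$, $w\in X^{k-\ell}$. Let $B=\mathrm{Alt}(\{x_1,\dots,x_r\}\times X)$ and, for $\ell\ge 2$, let $\phi_\ell\colon B\to\Omega_\ell$ be the homomorphism for which $\phi_\ell(\sigma)$ maps $x_d^{\ell-2}xy$ to $x_d^{\ell-2}\sigma(xy)$ for $x\in\{x_1,\dots,x_r\}$, $y\in X$, and fixes all other words of length $\ell$. In $P=\prod_{\ell\ge 1}\Omega_\ell$ put $$\Delta_1(\sigma)=(\sigma,\iota_{1,2}(\sigma),\iota_{1,3}(\sigma),\dots)\quad(\sigma\in\Omega_1),\qquad \tilde b=\Bigl(\prod_{k=2}^{\ell}\iota_{k,\ell}(\phi_k(b))\Bigr)_{\ell\ge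 1}\quad(b\in B),$$ where the factors of each product commute, and let $$G_{\mathcal A(d,r)}=\bigl\langle\,\Delta_1(\Omega_1)\cup\{\tilde b : b\in B\}\,\bigr\rangle\le P .$$ **Theorem.** The group $G_{\mathcal A(d,r)}$ is generated by two elements, and it is a frame in $\prod_{\ell\ge 1}\mathrm{Alt}(X^\ell)\cong\prod_{\ell\ge 1}\mathrm{Alt}(d^\ell)$. That is, it is a finitely generated subgroup, it contains the direct sum $\bigoplus_{\ell\ge 1}\mathrm{Alt}(X^\ell)$, and the continuous homomorphism $\widehat{G_{\mathcal A(d,r)}}\to\prod_{\ell\ge 1}\mathrm{Alt}(X^\ell)$ from its profinite completion that is induced by the inclusion is an isomorphism of profinite groups (where the product carries the product topology of the discrete topologies). -/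

import Mathlib

namespace AltTelescope

/-- The set `X ^ ℓ` of words of length `ℓ` over the alphabet `X = Fin d`. The letter written
`x_j` (`1 ≤ j ≤ d`) on paper is the element `j - 1` of `Fin d`. -/
abbrev Word (d ℓ : ℕ) : Type := Fin ℓ → Fin d

/-- `Ω_ℓ = Alt (X ^ ℓ)`. -/
abbrev Omega (d ℓ : ℕ) : Type := alternatingGroup (Word d ℓ)

/-- `B = Alt ({x_1, …, x_r} × X)`. -/
abbrev B (d r : ℕ) : Type := alternatingGroup ({x : Fin d // (x : ℕ) < r} × Fin d)

/-- Alternating groups have no non-trivial homomorphism to `{1, -1}`, because they are generated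
by elements of order three. -/
theorem sign_hom_eq_one {α : Type*} [Fintype α] [DecidableEq α]
    (f : alternatingGroup α →* ℤˣ) (σ : alternatingGroup α) : f σ = 1 := by
  have h : (⊤ : Subgroup (alternatingGroup α)) ≤ f.ker := by
    rw [← alternatingGroup.closure_isThreeCycles_eq_top, Subgroup.closure_le]
    intro g hg
    have h3 : g ^ 3 = 1 := by
      apply Subtype.ext
      have := pow_orderOf_eq_one (g : Equiv.Perm α)
      rw [Equiv.Perm.IsThreeCycle.orderOf hg] at this
      simpa using this
    have h4 : f g ^ 3 = 1 := by rw [← map_pow, h3, map_one]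
    rw [SetLike.mem_coe, MonoidHom.mem_ker]
    rw [pow_succ, Int.units_sq, one_mul] at h4
    exact h4
  exact h (Subgroup.mem_top σ)

/-- The restriction to alternating groups of a homomorphism between symmetric groups. -/
def altMap {α β : Type*} [Fintype α] [DecidableEq α] [Fintype β] [DecidableEq β]
    (f : Equiv.Perm α →* Equiv.Perm β) : alternatingGroup α →* alternatingGroup β :=
  (f.comp (alternatingGroup α).subtype).codRestrict (alternatingGroup β) fun σ =>
    sign_hom_eq_one (Equiv.Perm.sign.comp (f.comp (alternatingGroup α).subtype)) σ

/-- `v w ↦ f(v) w` for `v` of length `ℓ` and `w` of length `k - ℓ`. -/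
def prefixFun {d ℓ k : ℕ} (h : ℓ ≤ k) (f : Word d ℓ → Word d ℓ) (u : Word d k) : Word d k :=
  fun i => if hi : (i : ℕ) < ℓ then f (fun j => u (Fin.castLE h j)) ⟨i, hi⟩ else u i

theorem prefixFun_comp {d ℓ k : ℕ} (h : ℓ ≤ k) (f g : Word d ℓ → Word d ℓ) (u : Word d k) :
    prefixFun h f (prefixFun h g u) = prefixFun h (f ∘ g) u := by
  funext i
  by_cases hi : (i : ℕ) < ℓ <;> simp [prefixFun, hi]

theorem prefixFun_id {d ℓ k : ℕ} (h : ℓ ≤ k) (u : Word d k) :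
    prefixFun h (id : Word d ℓ → Word d ℓ) u = u := by
  funext i
  by_cases hi : (i : ℕ) < ℓ
  · simp only [prefixFun, hi, dite_true, id]
    rfl
  · simp [prefixFun, hi]

/-- A permutation of `X ^ ℓ`, acting on the prefix of length `ℓ` of the words in `X ^ k`. -/
def prefixPerm {d ℓ k : ℕ} (h : ℓ ≤ k) : Equiv.Perm (Word d ℓ) →* Equiv.Perm (Word d k) where
  toFun σ :=
    { toFun := prefixFun h σ
      invFun := prefixFun h σ.symm
      left_inv := fun u => by
        rw [prefixFun_comp, Equiv.symm_comp_self, prefixFun_id]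
      right_inv := fun u => by
        rw [prefixFun_comp, Equiv.self_comp_symm, prefixFun_id] }
  map_one' := Equiv.ext fun u => prefixFun_id h u
  map_mul' σ τ := Equiv.ext fun u => (prefixFun_comp h σ τ u).symm

/-- The transition map `ι_{ℓ,k} : Ω_ℓ → Ω_k`, `ι_{ℓ,k}(σ)(v w) = σ(v) w`. -/
def iota {d ℓ k : ℕ} (h : ℓ ≤ k) : Omega d ℓ →* Omega d k := altMap (prefixPerm h)

/-- The embedding `(x, y) ↦ x_d ^ m x y` of `{x_1, …, x_r} × X` into `X ^ (m + 2)`. -/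
def spine (d r m : ℕ) : ({x : Fin d // (x : ℕ) < r} × Fin d) ↪ Word d (m + 2) where
  toFun p := Fin.snoc (α := fun _ => Fin d)
    (Fin.snoc (α := fun _ => Fin d) (fun _ => ⟨d - 1, by have := p.2.isLt; omega⟩) p.1.1) p.2
  inj' p q hpq := by
    obtain ⟨h1, h2⟩ := Fin.snoc_injective2 hpq
    obtain ⟨-, h3⟩ := Fin.snoc_injective2 h1
    exact Prod.ext (Subtype.ext h3) h2

/-- The map `φ_ℓ : B → Ω_ℓ` for `ℓ = m + 2`: `φ_ℓ(σ)` maps `x_d ^ m x y` to `x_d ^ m σ(x y)` for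
`x ∈ {x_1, …, x_r}` and `y ∈ X`, and fixes all other words. -/
noncomputable def phi (d r m : ℕ) : B d r →* Omega d (m + 2) :=
  altMap (Equiv.Perm.viaEmbeddingHom (spine d r m))

/-- The factors of `P = ∏_{ℓ ≥ 1} Ω_ℓ`; the index `n : ℕ` stands for the level `ℓ = n + 1`. -/
abbrev Factor (d : ℕ) (n : ℕ) : Type := Omega d (n + 1)

/-- `Δ_1(σ) = (σ, ι_{1,2}(σ), ι_{1,3}(σ), …)`. -/
def deltaOne (d : ℕ) (σ : Omega d 1) : ∀ n, Factor d n :=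
  fun n => iota (Nat.le_add_left 1 n) σ

/-- The element `b~` of `P` whose component at level `ℓ` is the product of the
`ι_{k,ℓ}(φ_k(b))`, `2 ≤ k ≤ ℓ`. These permutations have disjoint supports when `r < d`, so that
the order of the factors does not matter (here `k = j + 2` increases). -/
noncomputable def tilde (d r : ℕ) (b : B d r) : ∀ n, Factor d n :=
  fun n => ((List.finRange n).map fun j : Fin n =>
    iota (show (j : ℕ) + 2 ≤ n + 1 by omega) (phi d r j b)).prod

/-- The group `G_{A(d,r)} = ⟨Δ_1(Ω_1), {b~ | b ∈ B}⟩ ≤ P` of the telescope `A(d,r)`. -/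
def telescopeGroup (d r : ℕ) : Subgroup (∀ n, Factor d n) :=
  Subgroup.closure (Set.range (deltaOne d) ∪ Set.range (tilde d r))

end AltTelescope

namespace Frame

/-- The product of the finite discrete groups `S n` as a profinite group (with the product
topology). -/
def profiniteProduct (S : ℕ → Type) [∀ n, Group (S n)] [∀ n, Finite (S n)] : ProfiniteGrp.{0} :=
  ProfiniteGrp.pi fun n => ProfiniteGrp.ofFiniteGrp (FiniteGrp.of (S n))

/-- The inclusion of a subgroup `G` into the profinite group `∏ S n`. -/
def inclusion {S : ℕ → Type} [∀ n, Group (S n)] [∀ n, Finite (S n)] (G : Subgroup (∀ n, S n)) :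
    GrpCat.of G ⟶ GrpCat.of (profiniteProduct S) :=
  GrpCat.ofHom (Y := profiniteProduct S)
    { toFun := fun g => (g : ∀ n, S n)
      map_one' := rfl
      map_mul' := fun _ _ => rfl }

/-- A frame for a product of finite groups: a finitely generated subgroup that contains the direct
sum and for which the continuous homomorphism from the profinite completion to the product
that is induced by the inclusion is an isomorphism of profinite groups. -/
structure IsFrame {S : ℕ → Type} [∀ n, Group (S n)] [∀ n, Finite (S n)]
    (G : Subgroup (∀ n, S n)) : Prop where
  fg : G.FG
  directSum_le : ∀ g : ∀ n, S n, {n | g n ≠ 1}.Finite → g ∈ G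
  completion_isIso :
    CategoryTheory.IsIso (ProfiniteGrp.ProfiniteCompletion.lift (inclusion G))

end Frame

/-! Write G_n for `tailGroup hr n`, generated by a copy `delta n` of Alt(X^(n+1)), acting on
prefixes in all coordinates from n on, and by the tails `tail hr n b`; G_0 is the telescope group. A
tail splits into its head `delta (n + 1) (phi d r n b)`, which only moves words with a prefix x_d^n
x, x among the first r letters, and the rest `tail hr (n + 1) b`, which only moves words with prefix
x_d^(n+1). As r ≤ d - 3, some even permutation of the prefixes fixes every x_d^n x and moves
x_d^(n+1). Conjugating one tail by it makes the rests commute with everything in sight, so the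
commutator with a second tail is a pure head (`commutator_delta_conj_tail`). Since B is perfect, G_n
contains all heads, and their conjugates generate the whole copy `delta (n + 1)`. Hence G_(n+1) ≤
G_n, and dividing `delta n σ` by its continuation at n + 1 isolates one coordinate: G_0 contains the
direct sum. Truncation shows that the elements of G_0 trivial below n lie in G_n.

Profinite completion: a homomorphism from G_n to a group smaller than its first factor kills the
simple groups `delta n` and `delta (n + 1)`. The commutator identity then makes the images of the
tails commute, so they vanish because B is perfect (`monoidHom_tailGroup_eq_one`). Thus every normal
subgroup of finite index contains some G_n, which gives injectivity; surjectivity is density plus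
compactness.

Two generators: for large n there is room to place disjoint conjugates of the tails of all
involutions of B in one element q₀ commuting with a three-cycle τ. Together with a suitable σ, the
product of `delta n τ` and q₀ generates G_n: orders 3 and 2 separate the two parts, and commutators
of shifted copies of q₀ recover the tails. The coordinates below n are filled with generating pairs
of the simple factors, and a Goursat argument (`tailGroup_le_map_truncate`) descends to G_0, since
G_(k+1) has no quotient isomorphic to the factor at k. -/

namespace AltTelescope

open Equiv Equiv.Perm
open scoped commutatorElement

/-! ### Three-cycles and generation of alternating groups -/

section ThreeCycles

variable {α : Type*} [DecidableEq α]

/-- The three-cycle `a ↦ b ↦ c ↦ a`. -/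
def triCycle (a b c : α) : Perm α := swap a b * swap b c

theorem conj_triCycle (g : Perm α) (a b c : α) :
    g * triCycle a b c * g⁻¹ = triCycle (g a) (g b) (g c) := by
  simp only [triCycle, Equiv.swap_apply_apply]
  group

theorem triCycle_apply_left {a b c : α} (hab : a ≠ b) (hac : a ≠ c) : triCycle a b c a = b := by
  simp [triCycle, swap_apply_of_ne_of_ne hab hac]

theorem triCycle_apply_mid {a b c : α} (hac : a ≠ c) (hbc : b ≠ c) : triCycle a b c b = c := by
  simp [triCycle, swap_apply_of_ne_of_ne hac.symm hbc.symm]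

theorem triCycle_apply_right (a b c : α) : triCycle a b c c = a := by
  simp [triCycle]

theorem triCycle_apply_of_ne {a b c x : α} (ha : x ≠ a) (hb : x ≠ b) (hc : x ≠ c) :
    triCycle a b c x = x := by
  simp [triCycle, swap_apply_of_ne_of_ne ha hb, swap_apply_of_ne_of_ne hb hc]

theorem triCycle_inv (a b c : α) : (triCycle a b c)⁻¹ = triCycle c b a := by
  simp [triCycle, swap_comm]

theorem triCycle_rotate {a b c : α} (hab : a ≠ b) (hac : a ≠ c) (hbc : b ≠ c) :
    triCycle a b c = triCycle b c a := by
  have := conj_triCycle (triCycle a b c) a b c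
  rwa [triCycle_apply_left hab hac, triCycle_apply_mid hac hbc, triCycle_apply_right,
    mul_inv_cancel_right] at this

theorem triCycle_mem_conj {H : Subgroup (Perm α)} {g : Perm α} {a b c a' b' c' : α} (hg : g ∈ H)
    (h : triCycle a b c ∈ H) (ha : g a = a') (hb : g b = b') (hc : g c = c') :
    triCycle a' b' c' ∈ H := by
  subst ha hb hc
  rw [← conj_triCycle]
  exact H.mul_mem (H.mul_mem hg h) (H.inv_mem hg)

/-- Consecutive three-cycles along a path give the three-cycles through its first two points. -/
theorem triCycle_mem_of_path {H : Subgroup (Perm α)} {k : ℕ} (hk : 5 ≤ k) {a : ℕ → α}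
    (ha : Set.InjOn a (Set.Iio k))
    (h : ∀ i, i + 2 < k → triCycle (a i) (a (i + 1)) (a (i + 2)) ∈ H) {j : ℕ} (hj : 2 ≤ j)
    (hjk : j < k) : triCycle (a 0) (a 1) (a j) ∈ H := by
  have hne : ∀ i j, i < k → j < k → i ≠ j → a i ≠ a j := fun i j hi hj hij hh =>
    hij (ha hi hj hh)
  induction j, hj using Nat.le_induction with
  | base => exact h 0 (by omega)
  | succ j hj ih =>
    have ih := ih (by omega)
    -- The conjugator must send `a j` to `a (j + 1)` and fix `a 0`, `a 1`. The cycle starting at `a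
    -- (j - 1)` does so unless j = 2, where it would move `a 1`; there the cycle on `a 2, a 3, a 4`
    -- serves, hence `5 ≤ k`.
    rcases Nat.lt_or_ge j 3 with h3 | h3
    · obtain rfl : j = 2 := by omega
      refine triCycle_mem_conj (h 2 (by omega)) ih (triCycle_apply_of_ne ?_ ?_ ?_)
        (triCycle_apply_of_ne ?_ ?_ ?_) (triCycle_apply_left ?_ ?_) <;>
      exact hne _ _ (by omega) (by omega) (by omega)
    · obtain ⟨j, rfl⟩ : ∃ i, j = i + 1 := ⟨j - 1, by omega⟩
      refine triCycle_mem_conj (h j (by omega)) ih (triCycle_apply_of_ne ?_ ?_ ?_)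
        (triCycle_apply_of_ne ?_ ?_ ?_) (triCycle_apply_mid ?_ ?_) <;>
      exact hne _ _ (by omega) (by omega) (by omega)

theorem triCycle_mem_of_shift {H : Subgroup (Perm α)} {a : ℕ → α} {σ : Perm α}
    (hσ : σ ∈ H) (hs : ∀ i, σ (a i) = a (i + 1)) (h0 : triCycle (a 0) (a 1) (a 2) ∈ H) (i : ℕ) :
    triCycle (a i) (a (i + 1)) (a (i + 2)) ∈ H := by
  induction i with
  | zero => exact h0
  | succ i ih => exact triCycle_mem_conj hσ ih (hs _) (hs _) (hs _)

variable [Fintype α]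

theorem isThreeCycle_triCycle {a b c : α} (hab : a ≠ b) (hac : a ≠ c) (hbc : b ≠ c) :
    (triCycle a b c).IsThreeCycle := by
  rw [triCycle, swap_comm]
  exact isThreeCycle_swap_mul_swap_same hab.symm hbc hac

theorem alternatingGroup_le_of_triCycle {H : Subgroup (Perm α)}
    (h : ∀ a b c : α, a ≠ b → a ≠ c → b ≠ c → triCycle a b c ∈ H) : alternatingGroup α ≤ H := by
  rw [← closure_three_cycles_eq_alternating, Subgroup.closure_le]
  intro g hg
  have hg3 : g.IsThreeCycle := hg
  obtain ⟨a, ha⟩ := hg3.isCycle.nonempty_support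
  have h1 := hg3.eq_swap_mul_swap_iff_mem_support.2 ha
  have h2 := hg3.nodup_iff_mem_support.2 ha
  simp only [List.nodup_cons, List.mem_cons, List.not_mem_nil, or_false, not_or] at h2
  rw [SetLike.mem_coe, h1]
  exact h _ _ _ h2.1.1 h2.1.2 h2.2.1

/-- A subgroup containing, for any two points, three-cycles through them whose third point avoids
any two further points, contains the alternating group. -/
theorem alternatingGroup_le_of_exists_triCycle {H : Subgroup (Perm α)}
    (h : ∀ a b : α, a ≠ b → ∀ x y, ∃ c, c ≠ a ∧ c ≠ b ∧ c ≠ x ∧ c ≠ y ∧ triCycle a b c ∈ H) :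
    alternatingGroup α ≤ H := by
  refine alternatingGroup_le_of_triCycle fun a b e hab hae hbe => ?_
  -- Conjugating the cycle (a b c) by a cycle (c e f) with f outside {a, b} replaces the third point
  -- c by e.
  obtain ⟨c, hca, hcb, hce, -, hc⟩ := h a b hab e e
  obtain ⟨f, hfc, hfe, hfa, hfb, hf⟩ := h c e hce a b
  exact triCycle_mem_conj hf hc (triCycle_apply_of_ne hca.symm hae hfa.symm)
    (triCycle_apply_of_ne hcb.symm hbe hfb.symm) (triCycle_apply_left hce hfc.symm)

/-- The three-cycles through two fixed points generate the alternating group. -/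
theorem alternatingGroup_le_of_star {H : Subgroup (Perm α)} {o i : α} (hoi : o ≠ i)
    (h : ∀ j, j ≠ o → j ≠ i → triCycle o i j ∈ H) : alternatingGroup α ≤ H := by
  have h1 : ∀ k j, k ≠ o → k ≠ i → j ≠ o → j ≠ i → k ≠ j → triCycle i k j ∈ H := by
    intro k j hko hki hjo hji hkj
    exact triCycle_mem_conj (h k hko hki) (h j hjo hji) (triCycle_apply_left hoi hko.symm)
      (triCycle_apply_mid hko.symm hki.symm) (triCycle_apply_of_ne hjo hji hkj.symm)
  have h0 : ∀ k j, k ≠ o → k ≠ i → j ≠ o → j ≠ i → k ≠ j → triCycle o k j ∈ H := by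
    intro k j hko hki hjo hji hkj
    have := h1 k j hko hki hjo hji hkj
    have h2 : triCycle k o i ∈ H := by
      rw [triCycle_rotate hko hki hoi]; exact h k hko hki
    have h3 : triCycle i o j ∈ H := by
      rw [← triCycle_inv, triCycle_rotate hjo hji hoi]; exact H.inv_mem (h j hjo hji)
    refine triCycle_mem_conj (H.inv_mem h2) h3 (a' := o) (b' := k) (c' := j) ?_ ?_ ?_
    · rw [triCycle_inv]; exact triCycle_apply_left hoi.symm hki.symm
    · rw [triCycle_inv]; exact triCycle_apply_mid hki.symm hko.symm
    · rw [triCycle_inv]; exact triCycle_apply_of_ne hji hjo hkj.symm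
  have h2 : ∀ l k j, l ≠ o → l ≠ i → k ≠ o → k ≠ i → j ≠ o → j ≠ i → l ≠ k → l ≠ j → k ≠ j →
      triCycle l k j ∈ H := by
    intro l k j hlo hli hko hki hjo hji hlk hlj hkj
    exact triCycle_mem_conj (h l hlo hli) (h1 k j hko hki hjo hji hkj)
      (triCycle_apply_mid hlo.symm hli.symm) (triCycle_apply_of_ne hko hki hlk.symm)
      (triCycle_apply_of_ne hjo hji hlj.symm)
  have hrot : ∀ a b c, a ≠ b → a ≠ c → b ≠ c → triCycle b c a ∈ H → triCycle a b c ∈ H := by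
    intro a b c hab hac hbc h
    rwa [triCycle_rotate hab hac hbc]
  have hinv : ∀ a b c, triCycle c b a ∈ H → triCycle a b c ∈ H := by
    intro a b c h
    rw [← triCycle_inv]; exact H.inv_mem h
  refine alternatingGroup_le_of_triCycle fun a b c hab hac hbc => ?_
  by_cases hao : a = o <;> by_cases hbo : b = o <;> by_cases hco : c = o <;>
    by_cases hai : a = i <;> by_cases hbi : b = i <;> by_cases hci : c = i <;> grind

theorem injOn_ofNat (n : ℕ) :
    Set.InjOn (fun i : ℕ => Fin.ofNat (n + 1) i) (Set.Iio (n + 1)) := by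
  intro i hi j hj hij
  have := congrArg Fin.val hij
  simpa [Nat.mod_eq_of_lt hi, Nat.mod_eq_of_lt hj] using this

theorem ofNat_succ (n i : ℕ) : Fin.ofNat (n + 1) (i + 1) = Fin.ofNat (n + 1) i + 1 := by
  ext
  simp [Fin.val_add]

/-- The alternating group of at least five points is generated by two permutations, one of which
is a three-cycle. -/
theorem exists_two_generators (hα : 5 ≤ Fintype.card α) :
    ∃ σ τ : alternatingGroup α, (τ : Perm α).IsThreeCycle ∧ Subgroup.closure {σ, τ} = ⊤ := by
  suffices h : ∃ σ τ : Perm α, sign σ = 1 ∧ τ.IsThreeCycle ∧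
      alternatingGroup α ≤ Subgroup.closure {σ, τ} by
    obtain ⟨σ, τ, hσ, hτ, h⟩ := h
    refine ⟨⟨σ, hσ⟩, ⟨τ, hτ.mem_alternatingGroup⟩, hτ, ?_⟩
    apply Subgroup.map_injective (alternatingGroup α).subtype_injective
    rw [MonoidHom.map_closure, ← MonoidHom.range_eq_map, Subgroup.range_subtype,
      Set.image_pair]
    refine le_antisymm ?_ h
    rw [Subgroup.closure_le]
    rintro x (rfl | rfl)
    · exact hσ
    · exact hτ.mem_alternatingGroup
  rcases Nat.even_or_odd (Fintype.card α) with he | ho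
  -- For an even number of points the full cycle is odd, so σ rotates all points but one, `e none`,
  -- and the three-cycle passes through that fixed point.
  · obtain ⟨n, hn⟩ : ∃ n, Fintype.card α = n + 2 := ⟨Fintype.card α - 2, by omega⟩
    have hne : Even n := by rw [hn] at he; exact (Nat.even_add.1 he).2 even_two
    have h4 : 5 ≤ n + 1 := by
      obtain ⟨m, rfl⟩ := hne
      omega
    obtain ⟨e⟩ : Nonempty (Option (Fin (n + 1)) ≃ α) := by
      rw [← Fintype.card_eq]; simp [hn]
    set a : ℕ → α := fun i => e (some (Fin.ofNat (n + 1) i)) with ha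
    set σ : Perm α := e.permCongr (optionCongr (finRotate (n + 1))) with hσ
    have hs : ∀ i, σ (a i) = a (i + 1) := by
      intro i; simp [hσ, ha, finRotate_apply, ← ofNat_succ, -Fin.ofNat_eq_cast]
    have hinj : Set.InjOn a (Set.Iio (n + 1)) := fun i hi j hj hij =>
      injOn_ofNat n hi hj (Option.some_injective _ (e.injective hij))
    have h01 : a 0 ≠ a 1 := fun h => by
      have := hinj (by simp) (by simp; omega) h
      omega
    have h02 : a 0 ≠ a 2 := fun h => by
      have := hinj (by simp) (by simp; omega) h
      omega
    have h12 : a 1 ≠ a 2 := fun h => by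
      have := hinj (by simp; omega) (by simp; omega) h
      omega
    have hnone : ∀ i, e none ≠ a i := fun i h => by simp [ha] at h
    refine ⟨σ, triCycle (a 0) (a 1) (e none), ?_,
      isThreeCycle_triCycle h01 (hnone 0).symm (hnone 1).symm, ?_⟩
    · rw [hσ, sign_permCongr, optionCongr_sign, sign_finRotate]
      simpa using hne.neg_one_pow
    · set H := Subgroup.closure {σ, triCycle (a 0) (a 1) (e none)} with hH
      have hσm : σ ∈ H := Subgroup.subset_closure (by simp)
      have hτm : triCycle (a 0) (a 1) (e none) ∈ H := Subgroup.subset_closure (by simp)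
      have hfix : σ (e none) = e none := by simp [hσ]
      have h1 : triCycle (a 1) (a 2) (e none) ∈ H :=
        triCycle_mem_conj hσm hτm (hs 0) (hs 1) hfix
      -- Combining τ with its σ-conjugate eliminates the fixed point and leaves a cycle on three
      -- consecutive points of the rotation.
      have h2 : triCycle (a 0) (a 2) (a 1) ∈ H :=
        triCycle_mem_conj h1 hτm (triCycle_apply_of_ne h01 h02 (hnone 0).symm)
          (triCycle_apply_left h12 (hnone 1).symm) (triCycle_apply_right _ _ _)
      have h3 : triCycle (a 0) (a 1) (a 2) ∈ H := by
        rw [triCycle_rotate h01 h02 h12, ← triCycle_inv]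
        exact H.inv_mem h2
      refine alternatingGroup_le_of_star h01 fun j hj0 hj1 => ?_
      obtain ⟨x, rfl⟩ := e.surjective j
      cases x with
      | none => exact hτm
      | some x =>
        have hx : e (some x) = a x := by simp [ha]
        rw [hx] at hj0 hj1 ⊢
        refine triCycle_mem_of_path h4 hinj
          (fun i _ => triCycle_mem_of_shift hσm hs h3 i) ?_ x.2
        by_contra hlt
        have : (x : ℕ) = 0 ∨ (x : ℕ) = 1 := by omega
        rcases this with h | h <;> rw [h] at hj0 hj1 <;> contradiction
  · obtain ⟨n, hn⟩ : ∃ n, Fintype.card α = n + 1 := ⟨Fintype.card α - 1, by omega⟩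
    have hne : Even n := by
      rw [hn] at ho
      simpa [Nat.odd_add_one] using ho
    obtain ⟨e⟩ : Nonempty (Fin (n + 1) ≃ α) := by
      rw [← Fintype.card_eq]; simp [hn]
    set a : ℕ → α := fun i => e (Fin.ofNat (n + 1) i) with ha
    set σ : Perm α := e.permCongr (finRotate (n + 1)) with hσ
    have hs : ∀ i, σ (a i) = a (i + 1) := by
      intro i; simp [hσ, ha, finRotate_apply, ← ofNat_succ, -Fin.ofNat_eq_cast]
    have hinj : Set.InjOn a (Set.Iio (n + 1)) := fun i hi j hj hij =>
      injOn_ofNat n hi hj (e.injective hij)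
    have h01 : a 0 ≠ a 1 := fun h => by
      have := hinj (by simp) (by simp; omega) h
      omega
    have h02 : a 0 ≠ a 2 := fun h => by
      have := hinj (by simp) (by simp; omega) h
      omega
    have h12 : a 1 ≠ a 2 := fun h => by
      have := hinj (by simp; omega) (by simp; omega) h
      omega
    refine ⟨σ, triCycle (a 0) (a 1) (a 2), ?_, isThreeCycle_triCycle h01 h02 h12, ?_⟩
    · rw [hσ, sign_permCongr, sign_finRotate]
      simpa using hne.neg_one_pow
    · refine alternatingGroup_le_of_star h01 fun j hj0 hj1 => ?_
      obtain ⟨x, rfl⟩ := e.surjective j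
      have hx : e x = a x := by simp [ha]
      rw [hx] at hj0 hj1 ⊢
      refine triCycle_mem_of_path (by omega) hinj (fun i _ => triCycle_mem_of_shift (σ := σ)
          (Subgroup.subset_closure (by simp)) hs (Subgroup.subset_closure (by simp)) i) ?_ x.2
      by_contra hlt
      have : (x : ℕ) = 0 ∨ (x : ℕ) = 1 := by omega
      rcases this with h | h <;> rw [h] at hj0 hj1 <;> contradiction

end ThreeCycles

/-! ### Extending partial injections; commutators of involutions -/

section Extension

variable {α : Type*} [Fintype α] [DecidableEq α]

/-- A partial injection that leaves out at least two points extends to an even permutation. -/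
theorem exists_alternating_extending {ι : Type*} [Fintype ι] (e f : ι ↪ α)
    (h : Fintype.card ι + 2 ≤ Fintype.card α) :
    ∃ σ : alternatingGroup α, ∀ i, (σ : Perm α) (e i) = f i := by
  have h0 := alternatingGroup.isMultiplyPretransitive α
  have h1 : MulAction.IsMultiplyPretransitive (alternatingGroup α) α (Fintype.card ι) := by
    refine MulAction.isMultiplyPretransitive_of_le (n := Nat.card α - 2) ?_ ?_
    · simp; omega
    · simp
  have ε := (Fintype.equivFin ι).symm
  obtain ⟨σ, hσ⟩ := h1.exists_smul_eq (ε.toEmbedding.trans e) (ε.toEmbedding.trans f)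
  refine ⟨σ, fun i => ?_⟩
  have := DFunLike.congr_fun hσ (ε.symm i)
  simpa [Subgroup.smul_def] using this

/-- The alternating group of at least five points is generated by the commutators of pairs of
involutions. -/
theorem closure_commutators_involutions (hα : 5 ≤ Fintype.card α) :
    Subgroup.closure {g : alternatingGroup α | ∃ w w' : alternatingGroup α,
      w ^ 2 = 1 ∧ w' ^ 2 = 1 ∧ ⁅w, w'⁆ = g} = ⊤ := by
  have hα' : 5 ≤ Nat.card α := by simpa using hα
  have hsimple := alternatingGroup.isSimpleGroup hα'
  set S := {g : alternatingGroup α | ∃ w w' : alternatingGroup α,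
      w ^ 2 = 1 ∧ w' ^ 2 = 1 ∧ ⁅w, w'⁆ = g} with hS
  have hn : (Subgroup.closure S).Normal := by
    refine ⟨fun g hg x => ?_⟩
    induction hg using Subgroup.closure_induction with
    | mem g hg =>
      obtain ⟨w, w', hw, hw', rfl⟩ := hg
      refine Subgroup.subset_closure ⟨x * w * x⁻¹, x * w' * x⁻¹, ?_, ?_, ?_⟩
      · rw [conj_pow, hw]; simp
      · rw [conj_pow, hw']; simp
      · simp only [commutatorElement_def]; group
    | one => simp
    | mul g g' _ _ h h' => simpa [mul_assoc] using Subgroup.mul_mem _ h h'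
    | inv g _ h => simpa [mul_assoc] using Subgroup.inv_mem _ h
  -- If all these commutators were trivial, involutions would commute; double transpositions
  -- generate, so the group would be abelian, although it is perfect.
  refine (hn.eq_bot_or_eq_top).resolve_left fun hbot => ?_
  have hcomm : ∀ w w' : alternatingGroup α, w ^ 2 = 1 → w' ^ 2 = 1 → Commute w w' := by
    intro w w' hw hw'
    rw [← commutatorElement_eq_one_iff_commute]
    rw [Subgroup.closure_eq_bot_iff] at hbot
    exact hbot ⟨w, w', hw, hw', rfl⟩
  have hgen := alternatingGroup.closure_cycleType_eq_two_two_eq_top (α := α) hα'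
  have hinv : ∀ g : alternatingGroup α, (g : Perm α).cycleType = {2, 2} → g ^ 2 = 1 := by
    intro g hg
    apply Subtype.ext
    have := pow_orderOf_eq_one (g : Perm α)
    rw [← lcm_cycleType, hg] at this
    simpa using this
  have hab : ∀ x y : alternatingGroup α, Commute x y := by
    intro x y
    have h1 : ∀ z : alternatingGroup α, (z : Perm α).cycleType = {2, 2} →
        z ∈ Subgroup.centralizer (⊤ : Subgroup (alternatingGroup α)) := by
      intro z hz
      rw [← hgen, Subgroup.centralizer_closure]
      rw [Subgroup.mem_centralizer_iff]
      intro w hw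
      exact (hcomm w z (hinv w hw) (hinv z hz)).eq
    have h2 : x ∈ Subgroup.centralizer (⊤ : Subgroup (alternatingGroup α)) := by
      have : x ∈ Subgroup.closure _ := hgen ▸ Subgroup.mem_top x
      exact (Subgroup.closure_le _).2 h1 this
    exact ((Subgroup.mem_centralizer_iff.1 h2) y (Subgroup.mem_top y)).symm
  have hc := commutator_alternatingGroup_eq_top (α := α) hα'
  rw [commutator_def, Subgroup.commutator_eq_bot_iff_le_centralizer.2] at hc
  · exact bot_ne_top hc
  · intro x _ y _
    exact (hab y x).eq

/-- A homomorphism of a perfect group with commuting values is trivial. -/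
theorem monoidHom_eq_one_of_commute {G Q : Type*} [Group G] [Group Q] (hG : commutator G = ⊤)
    (f : G →* Q) (h : ∀ x y, Commute (f x) (f y)) (x : G) : f x = 1 := by
  have : commutator G ≤ f.ker := by
    rw [commutator_def, Subgroup.commutator_le]
    intro a _ b _
    rw [MonoidHom.mem_ker, map_commutatorElement, commutatorElement_eq_one_iff_commute]
    exact h a b
  exact this (hG ▸ Subgroup.mem_top x)

end Extension

end AltTelescope

namespace AltTelescope

open Equiv Equiv.Perm
open scoped commutatorElement

/-! ### Words, prefixes and the transition maps -/

section Words

variable {d : ℕ}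

/-- The prefix of length `ℓ` of a word. -/
def take {ℓ k : ℕ} (h : ℓ ≤ k) (u : Word d k) : Word d ℓ := fun j => u (Fin.castLE h j)

theorem take_prefixFun {ℓ k : ℕ} (h : ℓ ≤ k) (f : Word d ℓ → Word d ℓ) (u : Word d k) :
    take h (prefixFun h f u) = f (take h u) := by
  funext j
  simp [take, prefixFun]
  rfl

theorem prefixFun_eq_self {ℓ k : ℕ} (h : ℓ ≤ k) {f : Word d ℓ → Word d ℓ} {u : Word d k}
    (hf : f (take h u) = take h u) : prefixFun h f u = u := by
  have : prefixFun h f u = prefixFun h id u := by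
    funext i
    by_cases hi : (i : ℕ) < ℓ
    · simp only [prefixFun, hi, dite_true, id]
      exact congrFun hf _
    · simp [prefixFun, hi]
  rw [this, prefixFun_id]

theorem coe_iota_apply {ℓ k : ℕ} (h : ℓ ≤ k) (σ : Omega d ℓ) (u : Word d k) :
    (iota h σ : Perm (Word d k)) u = prefixFun h (σ : Perm (Word d ℓ)) u := rfl

theorem take_iota {ℓ k : ℕ} (h : ℓ ≤ k) (σ : Omega d ℓ) (u : Word d k) :
    take h ((iota h σ : Perm (Word d k)) u) = (σ : Perm (Word d ℓ)) (take h u) :=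
  take_prefixFun h _ u

theorem iota_apply_eq_self {ℓ k : ℕ} (h : ℓ ≤ k) {σ : Omega d ℓ} {u : Word d k}
    (hσ : (σ : Perm (Word d ℓ)) (take h u) = take h u) : (iota h σ : Perm (Word d k)) u = u :=
  prefixFun_eq_self h hσ

theorem iota_self {ℓ : ℕ} (h : ℓ ≤ ℓ) (σ : Omega d ℓ) : iota h σ = σ := by
  apply Subtype.ext
  ext1 u
  rw [coe_iota_apply]
  exact take_prefixFun h _ u

theorem iota_iota {ℓ m k : ℕ} (h : ℓ ≤ m) (h' : m ≤ k) (σ : Omega d ℓ) :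
    iota h' (iota h σ) = iota (h.trans h') σ := by
  apply Subtype.ext
  ext1 u
  simp only [coe_iota_apply]
  funext i
  by_cases hi : (i : ℕ) < ℓ
  · have hi' : (i : ℕ) < m := hi.trans_le h
    simp only [prefixFun, hi, hi', dite_true, coe_iota_apply]
    rfl
  · by_cases hi' : (i : ℕ) < m
    · simp only [prefixFun, hi, hi', dite_true, dite_false, coe_iota_apply]
      rfl
    · simp [prefixFun, hi, hi']

theorem iota_snoc {ℓ : ℕ} (σ : Omega d ℓ) (v : Word d ℓ) (x : Fin d) :
    (iota (Nat.le_succ ℓ) σ : Perm (Word d (ℓ + 1))) (Fin.snoc (α := fun _ => Fin d) v x) =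
      Fin.snoc (α := fun _ => Fin d) ((σ : Perm (Word d ℓ)) v) x := by
  rw [coe_iota_apply]
  funext i
  refine Fin.lastCases ?_ (fun i => ?_) i
  · simp [prefixFun]
  · simp only [prefixFun, Fin.val_castSucc, i.2, dite_true, Fin.snoc_castSucc]
    have : (fun j => (Fin.snoc (α := fun _ => Fin d) v x : Word d (ℓ + 1))
        (Fin.castLE (Nat.le_succ ℓ) j)) = v := by
      funext j
      exact Fin.snoc_castSucc (α := fun _ => Fin d) x v j
    rw [this]

end Words

/-! ### Sequences of permutations and their supports -/

section Sequences

variable {d : ℕ}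

/-- The product `∏ Ω_ℓ`. -/
abbrev Seqs (d : ℕ) : Type := ∀ n, Factor d n

/-- The sequence that is trivial below the index `n` and is given by the action on prefixes from
there on. -/
def delta (n : ℕ) : Factor d n →* Seqs d where
  toFun σ k := if h : n ≤ k then iota (Nat.succ_le_succ h) σ else 1
  map_one' := by funext k; by_cases h : n ≤ k <;> simp [h]
  map_mul' σ τ := by funext k; by_cases h : n ≤ k <;> simp [h]

theorem delta_apply_of_le {n k : ℕ} (h : n ≤ k) (σ : Factor d n) :
    delta n σ k = iota (Nat.succ_le_succ h) σ := by
  simp [delta, h]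

theorem delta_apply_of_lt {n k : ℕ} (h : k < n) (σ : Factor d n) : delta n σ k = 1 := by
  simp [delta, Nat.not_le.2 h]

theorem delta_apply_self (n : ℕ) (σ : Factor d n) : delta n σ n = σ := by
  rw [delta_apply_of_le le_rfl, iota_self]

/-- The transition map between consecutive factors. -/
def lift (n : ℕ) : Factor d n →* Factor d (n + 1) := iota (Nat.le_succ (n + 1))

theorem delta_eq_mulSingle_mul (n : ℕ) (σ : Factor d n) :
    delta n σ = Pi.mulSingle n σ * delta (n + 1) (lift n σ) := by
  funext k
  rw [Pi.mul_apply]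
  rcases lt_trichotomy k n with h | rfl | h
  · rw [delta_apply_of_lt h, delta_apply_of_lt (by omega), Pi.mulSingle_eq_of_ne h.ne, mul_one]
  · rw [delta_apply_self, delta_apply_of_lt (by omega), Pi.mulSingle_eq_same, mul_one]
  · rw [delta_apply_of_le h.le, delta_apply_of_le h, Pi.mulSingle_eq_of_ne h.ne', one_mul, lift,
      iota_iota]

/-- The two conjugators differ only in coordinate n, where the conjugated sequence is trivial. -/
theorem delta_conj_delta (n : ℕ) (σ : Factor d n) (ρ : Factor d (n + 1)) :
    delta n σ * delta (n + 1) ρ * (delta n σ)⁻¹ =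
      delta (n + 1) (lift n σ * ρ * (lift n σ)⁻¹) := by
  rw [delta_eq_mulSingle_mul, map_mul, map_mul, map_inv]
  have hc : ∀ ρ' : Factor d (n + 1),
      Commute (Pi.mulSingle n σ : Seqs d) (delta (n + 1) ρ') := by
    intro ρ'
    funext k
    rw [Pi.mul_apply, Pi.mul_apply]
    rcases eq_or_ne k n with rfl | h
    · rw [delta_apply_of_lt (by omega), one_mul, mul_one]
    · rw [Pi.mulSingle_eq_of_ne h, one_mul, mul_one]
  have h1 := (hc (lift n σ * ρ * (lift n σ)⁻¹)).eq
  rw [map_mul, map_mul, map_inv] at h1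
  rw [mul_inv_rev, ← mul_assoc]
  rw [← mul_inv_eq_iff_eq_mul] at h1
  rw [← h1]
  group

/-- The elements of the product that are trivial up to the index `n` and move only words whose
prefix of length `n + 1` lies in `S`. -/
def supported (n : ℕ) (S : Set (Word d (n + 1))) : Subgroup (Seqs d) where
  carrier := {g | (∀ k ≤ n, g k = 1) ∧ ∀ k (h : n < k) (u : Word d (k + 1)),
    take (Nat.succ_le_succ h.le) u ∉ S → (g k : Perm (Word d (k + 1))) u = u}
  one_mem' := ⟨fun _ _ => rfl, fun _ _ _ _ => rfl⟩
  mul_mem' := by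
    rintro g g' ⟨h1, h2⟩ ⟨h1', h2'⟩
    refine ⟨fun k hk => by rw [Pi.mul_apply, h1 k hk, h1' k hk, one_mul], fun k hk u hu => ?_⟩
    rw [Pi.mul_apply, Subgroup.coe_mul, Perm.mul_apply, h2' k hk u hu, h2 k hk u hu]
  inv_mem' := by
    rintro g ⟨h1, h2⟩
    refine ⟨fun k hk => by rw [Pi.inv_apply, h1 k hk, inv_one], fun k hk u hu => ?_⟩
    rw [Pi.inv_apply, Subgroup.coe_inv, Perm.inv_eq_iff_eq, h2 k hk u hu]

theorem supported_mono {n : ℕ} {S T : Set (Word d (n + 1))} (h : S ⊆ T) :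
    supported n S ≤ supported n T :=
  fun _ hg => ⟨hg.1, fun k hk u hu => hg.2 k hk u fun hS => hu (h hS)⟩

theorem commute_of_disjoint_apply {g g' : Seqs d}
    (h : ∀ k, Perm.Disjoint (g k : Perm (Word d (k + 1))) (g' k)) : Commute g g' := by
  funext k
  exact Subtype.ext (h k).commute.eq

theorem commute_of_supported {n : ℕ} {S T : Set (Word d (n + 1))} (hST : Disjoint S T)
    {g g' : Seqs d} (hg : g ∈ supported n S) (hg' : g' ∈ supported n T) : Commute g g' := by
  refine commute_of_disjoint_apply fun k u => ?_
  rcases le_or_gt k n with hk | hk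
  · left; rw [hg.1 k hk]; rfl
  · by_cases hu : take (Nat.succ_le_succ hk.le) u ∈ S
    · exact Or.inr (hg'.2 k hk u fun hT => Set.disjoint_left.1 hST hu hT)
    · exact Or.inl (hg.2 k hk u hu)

theorem delta_commute_of_supported {n : ℕ} {S : Set (Word d (n + 1))} {σ : Factor d n}
    (hσ : ∀ v ∈ S, (σ : Perm (Word d (n + 1))) v = v) {g : Seqs d} (hg : g ∈ supported n S) :
    Commute (delta n σ) g := by
  refine commute_of_disjoint_apply fun k u => ?_
  rcases le_or_gt k n with hk | hk
  · right; rw [hg.1 k hk]; rfl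
  · by_cases hu : take (Nat.succ_le_succ hk.le) u ∈ S
    · left
      rw [delta_apply_of_le hk.le]
      exact iota_apply_eq_self _ (hσ _ hu)
    · exact Or.inr (hg.2 k hk u hu)

theorem delta_conj_mem_supported {n : ℕ} {S : Set (Word d (n + 1))} (σ : Factor d n) {g : Seqs d}
    (hg : g ∈ supported n S) :
    delta n σ * g * (delta n σ)⁻¹ ∈ supported n ((σ : Perm (Word d (n + 1))) '' S) := by
  refine ⟨fun k hk => ?_, fun k hk u hu => ?_⟩
  · rw [Pi.mul_apply, Pi.mul_apply, hg.1 k hk, mul_one, ← Pi.mul_apply, mul_inv_cancel,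
      Pi.one_apply]
  · rw [Pi.mul_apply, Pi.mul_apply, Pi.inv_apply, delta_apply_of_le hk.le, Subgroup.coe_mul,
      Subgroup.coe_mul, Perm.mul_apply, Perm.mul_apply, hg.2 k hk]
    · rw [Subgroup.coe_inv, ← Perm.mul_apply, mul_inv_cancel, Perm.one_apply]
    · intro hS
      refine hu ⟨_, hS, ?_⟩
      rw [← map_inv, take_iota, Subgroup.coe_inv, ← Perm.mul_apply, mul_inv_cancel, Perm.one_apply]

/-- The quotient of the two permutations fixes S pointwise, so its sequence commutes with g.
Conjugators may therefore be prescribed on S alone. -/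
theorem delta_conj_eq_of_eqOn {n : ℕ} {S : Set (Word d (n + 1))} {σ τ : Factor d n}
    (h : ∀ v ∈ S, (σ : Perm (Word d (n + 1))) v = (τ : Perm (Word d (n + 1))) v) {g : Seqs d}
    (hg : g ∈ supported n S) :
    delta n σ * g * (delta n σ)⁻¹ = delta n τ * g * (delta n τ)⁻¹ := by
  have hc : Commute (delta n (τ⁻¹ * σ)) g := by
    refine delta_commute_of_supported (fun v hv => ?_) hg
    rw [Subgroup.coe_mul, Perm.mul_apply, h v hv, Subgroup.coe_inv, ← Perm.mul_apply, inv_mul_cancel,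
      Perm.one_apply]
  have h1 : σ = τ * (τ⁻¹ * σ) := by group
  rw [h1, map_mul, mul_assoc (delta n τ), hc.eq]
  group

end Sequences

/-! ### Tails, their heads, and the commutator identity -/

section Tail

variable {d r : ℕ}

/-- The word `v` starts with `x_d ^ j x` for one of the first `r` letters `x`. -/
def StartsSpine (r j : ℕ) {k : ℕ} (v : Word d k) : Prop :=
  ∀ i : Fin k, ((i : ℕ) < j → (v i : ℕ) = d - 1) ∧ ((i : ℕ) = j → (v i : ℕ) < r)

theorem spine_apply {m : ℕ} (p : {x : Fin d // (x : ℕ) < r} × Fin d) :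
    spine d r m p = Fin.snoc (α := fun _ => Fin d)
      (Fin.snoc (α := fun _ => Fin d) (fun _ => ⟨d - 1, by have := p.2.isLt; omega⟩) p.1.1) p.2 :=
  rfl

theorem startsSpine_of_mem_range {m : ℕ} {v : Word d (m + 2)} (h : v ∈ Set.range (spine d r m)) :
    StartsSpine r m v := by
  obtain ⟨p, rfl⟩ := h
  intro i
  refine Fin.lastCases ?_ (fun i => ?_) i
  · simp
  · refine Fin.lastCases ?_ (fun i => ?_) i
    · simp [spine_apply, p.1.2]
    · simp [spine_apply, i.2.ne]

theorem phi_apply_eq_self {m : ℕ} (b : B d r) {v : Word d (m + 2)} (h : ¬ StartsSpine r m v) :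
    (phi d r m b : Perm (Word d (m + 2))) v = v :=
  viaEmbedding_apply_of_notMem _ _ _ fun hv => h (startsSpine_of_mem_range hv)

/-- The contribution of level `j + 2` to the component at index `k` of `b~`. -/
noncomputable def tailFactor (d r k j : ℕ) : B d r →* Factor d k :=
  if h : j + 2 ≤ k + 1 then (iota h).comp (phi d r j) else 1

theorem tailFactor_apply_eq_self {k j : ℕ} (b : B d r) {u : Word d (k + 1)}
    (h : ¬ StartsSpine r j u) : (tailFactor d r k j b : Perm (Word d (k + 1))) u = u := by
  by_cases hj : j + 2 ≤ k + 1
  · simp only [tailFactor, hj, dite_true, MonoidHom.comp_apply]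
    refine iota_apply_eq_self _ (phi_apply_eq_self b fun hs => h fun i => ?_)
    by_cases hi : (i : ℕ) < j + 2
    · exact hs ⟨i, hi⟩
    · exact ⟨fun h => by omega, fun h => by omega⟩
  · simp [tailFactor, hj]

/-- The product of the contributions of `len` consecutive levels. -/
noncomputable def tailProd (d r k n len : ℕ) (b : B d r) : Factor d k :=
  ((List.range' n len).map fun j => tailFactor d r k j b).prod

theorem tailProd_succ (k n len : ℕ) (b : B d r) :
    tailProd d r k n (len + 1) b = tailFactor d r k n b * tailProd d r k (n + 1) len b := by
  simp [tailProd, List.range'_succ]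

theorem tailProd_apply_eq_self {k n len : ℕ} (b : B d r) {u : Word d (k + 1)} {i : Fin (k + 1)}
    (hi : (i : ℕ) < n) (hu : (u i : ℕ) ≠ d - 1) :
    (tailProd d r k n len b : Perm (Word d (k + 1))) u = u := by
  induction len generalizing n with
  | zero => simp [tailProd]
  | succ len ih =>
    rw [tailProd_succ, Subgroup.coe_mul, Perm.mul_apply, ih (by omega)]
    exact tailFactor_apply_eq_self b fun hs => hu ((hs i).1 hi)

/-- The supports are disjoint, as the letter at position n shows: the first factor needs it among
the first r letters, the later ones need it to be x_d. -/
theorem commute_tailFactor_tailProd (hr : r < d) (k n len : ℕ) (b b' : B d r) :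
    Commute (tailFactor d r k n b) (tailProd d r k (n + 1) len b') := by
  by_cases hn : n + 2 ≤ k + 1
  · apply Subtype.ext
    refine (Perm.Disjoint.commute fun u => ?_).eq
    by_cases hu : ((u ⟨n, by omega⟩ : Fin d) : ℕ) = d - 1
    · exact Or.inl (tailFactor_apply_eq_self b fun hs => by
        have := (hs ⟨n, by omega⟩).2 rfl
        omega)
    · exact Or.inr (tailProd_apply_eq_self b' (i := ⟨n, by omega⟩) (Nat.lt_succ_self n) hu)
  · simp [tailFactor, hn]

theorem tailProd_mul (hr : r < d) (k n len : ℕ) (b b' : B d r) :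
    tailProd d r k n len (b * b') = tailProd d r k n len b * tailProd d r k n len b' := by
  induction len generalizing n with
  | zero => simp [tailProd]
  | succ len ih =>
    rw [tailProd_succ, tailProd_succ, tailProd_succ, ih, map_mul]
    have := (commute_tailFactor_tailProd hr k n len b' b).eq
    simp only [mul_assoc]
    rw [← mul_assoc (tailFactor d r k n b'), this]
    simp only [mul_assoc]

/-- The sequence of the products of the contributions of all levels from `n + 2` on. -/
noncomputable def tail (hr : r < d) (n : ℕ) : B d r →* Seqs d :=
  MonoidHom.mk' (fun b k => tailProd d r k n (k - n) b) fun b b' => by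
    funext k
    exact tailProd_mul hr k n (k - n) b b'

theorem tail_apply (hr : r < d) (n k : ℕ) (b : B d r) :
    tail hr n b k = tailProd d r k n (k - n) b := rfl

theorem tail_apply_of_le (hr : r < d) {n k : ℕ} (h : k ≤ n) (b : B d r) : tail hr n b k = 1 := by
  simp [tail_apply, Nat.sub_eq_zero_of_le h, tailProd]

theorem tail_eq_delta_mul (hr : r < d) (n : ℕ) (b : B d r) :
    tail hr n b = delta (n + 1) (phi d r n b) * tail hr (n + 1) b := by
  funext k
  rw [Pi.mul_apply]
  rcases Nat.lt_or_ge n k with h | h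
  · rw [delta_apply_of_le h, tail_apply, tail_apply,
      show k - n = (k - (n + 1)) + 1 by omega, tailProd_succ]
    congr 1
    have : n + 2 ≤ k + 1 := by omega
    simp only [tailFactor, this, dite_true, MonoidHom.comp_apply]
  · rw [tail_apply_of_le hr h, delta_apply_of_lt (by omega), tail_apply_of_le hr (by omega),
      one_mul]

theorem deltaOne_eq_delta (σ : Omega d 1) : deltaOne d σ = delta 0 σ := by
  funext k
  rw [delta_apply_of_le (Nat.zero_le k)]
  rfl

theorem tilde_eq_tail (hr : r < d) (b : B d r) : tilde d r b = tail hr 0 b := by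
  funext k
  rw [tail_apply, tailProd, tilde, Nat.sub_zero, ← List.range_eq_range',
    ← List.map_coe_finRange_eq_range, List.map_map]
  congr 2
  funext j
  simp [tailFactor]

/-- The word `x_d ^ (n + 1)`. -/
def corner (hr : r < d) (n : ℕ) : Word d (n + 1) := fun _ => ⟨d - 1, by omega⟩

/-- The words `x_d ^ n x` with one of the first `r` letters `x`. -/
def spineStem (d r n : ℕ) : Set (Word d (n + 1)) := {v | StartsSpine r n v}

theorem corner_notMem_spineStem (hr : r < d) (n : ℕ) : corner hr n ∉ spineStem d r n := by
  intro h
  have := (h (Fin.last n)).2 rfl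
  simp only [corner] at this
  omega

theorem delta_phi_mem_supported (n : ℕ) (b : B d r) :
    delta (n + 1) (phi d r n b) ∈ supported n (spineStem d r n) := by
  refine ⟨fun k hk => delta_apply_of_lt (by omega) _, fun k hk u hu => ?_⟩
  rw [delta_apply_of_le hk]
  refine iota_apply_eq_self _ (phi_apply_eq_self b fun hs => hu fun i => ?_)
  exact hs (Fin.castSucc i)

theorem tail_succ_mem_supported (hr : r < d) (n : ℕ) (b : B d r) :
    tail hr (n + 1) b ∈ supported n {corner hr n} := by
  refine ⟨fun k hk => tail_apply_of_le hr (by omega) b, fun k hk u hu => ?_⟩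
  obtain ⟨i, hi⟩ : ∃ i : Fin (n + 1), ((u (Fin.castLE (Nat.succ_le_succ hk.le) i) : Fin d) : ℕ)
      ≠ d - 1 := by
    by_contra! h
    refine hu ?_
    rw [Set.mem_singleton_iff]
    funext i
    exact Fin.ext (h i)
  exact tailProd_apply_eq_self b (i := Fin.castLE (Nat.succ_le_succ hk.le) i) i.2 hi

theorem tail_mem_supported (hr : r < d) (n : ℕ) (b : B d r) :
    tail hr n b ∈ supported n (insert (corner hr n) (spineStem d r n)) := by
  rw [tail_eq_delta_mul]
  exact mul_mem (supported_mono (Set.subset_insert _ _) (delta_phi_mem_supported n b))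
    (supported_mono (by simp) (tail_succ_mem_supported hr n b))

/-- Here a and b will be the parts that interact, x and y the parts whose supports have been moved
out of the way. -/
theorem commutator_mul_mul {G : Type*} [Group G] {a x b y : G} (hxb : Commute x b)
    (hxy : Commute x y) (hay : Commute a y) : ⁅a * x, b * y⁆ = ⁅a, b⁆ := by
  have h1 : a * x * (b * y) = a * b * y * x := by
    rw [mul_assoc, ← mul_assoc x, hxb.eq, mul_assoc b, hxy.eq]
    simp only [mul_assoc]
  rw [commutatorElement_def, h1, commutatorElement_def]
  have h2 : y * a⁻¹ = a⁻¹ * y := hay.symm.inv_right.eq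
  calc a * b * y * x * (a * x)⁻¹ * (b * y)⁻¹ = a * b * (y * a⁻¹) * y⁻¹ * b⁻¹ := by
        rw [mul_inv_rev]
        simp only [mul_assoc, mul_inv_rev, mul_inv_cancel_left]
    _ = _ := by rw [h2]; group

/-- Conjugation by a permutation that moves `x_d ^ (n + 1)` separates the head of a tail element
from the rest. -/
theorem commutator_delta_conj_tail (hr : r < d) {n : ℕ} {σ : Factor d n}
    (hσ : ∀ v ∈ spineStem d r n, (σ : Perm (Word d (n + 1))) v = v)
    (ho : (σ : Perm (Word d (n + 1))) (corner hr n) ≠ corner hr n) (b b' : B d r) :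
    ⁅delta n σ * tail hr n b * (delta n σ)⁻¹, tail hr n b'⁆ =
      delta (n + 1) (phi d r n ⁅b, b'⁆) := by
  have hoS : (σ : Perm (Word d (n + 1))) (corner hr n) ∉ spineStem d r n := fun h => by
    have := hσ _ h
    rw [EmbeddingLike.apply_eq_iff_eq] at this
    exact ho this
  have hD := delta_conj_mem_supported σ (tail_succ_mem_supported hr n b)
  rw [Set.image_singleton] at hD
  have hA := delta_commute_of_supported hσ (delta_phi_mem_supported (r := r) n b)
  -- The head commutes with σ, while the rest is carried from the corner to its image under σ, which
  -- is outside the support of the other tail.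
  have e1 : delta n σ * tail hr n b * (delta n σ)⁻¹ = delta (n + 1) (phi d r n b) *
      (delta n σ * tail hr (n + 1) b * (delta n σ)⁻¹) := by
    rw [tail_eq_delta_mul hr n b, ← mul_assoc, hA.eq]
    simp only [mul_assoc]
  rw [e1, tail_eq_delta_mul hr n b', commutator_mul_mul, map_commutatorElement,
    map_commutatorElement]
  · exact commute_of_supported (by simpa using hoS) hD (delta_phi_mem_supported n b')
  · exact commute_of_supported (by simpa using ho) hD (tail_succ_mem_supported hr n b')
  · exact commute_of_supported (by simpa using corner_notMem_spineStem hr n)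
      (delta_phi_mem_supported n b) (tail_succ_mem_supported hr n b')

end Tail

end AltTelescope

namespace AltTelescope

open Equiv Equiv.Perm
open scoped commutatorElement

/-! ### The descending chain of tail groups and their finite quotients -/

section TailGroup

variable {d r : ℕ}

theorem viaEmbeddingHom_triCycle {α β : Type*} [DecidableEq α] [DecidableEq β] (f : α ↪ β)
    (a b c : α) : viaEmbeddingHom f (triCycle a b c) = triCycle (f a) (f b) (f c) := by
  ext x
  by_cases hx : x ∈ Set.range f
  · obtain ⟨y, rfl⟩ := hx
    rw [viaEmbeddingHom_apply, viaEmbedding_apply]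
    simp [triCycle, f.injective.swap_apply]
  · have hne : ∀ y, x ≠ f y := fun y h => hx ⟨y, h.symm⟩
    rw [viaEmbeddingHom_apply, viaEmbedding_apply_of_notMem _ _ _ hx,
      triCycle_apply_of_ne (hne a) (hne b) (hne c)]

theorem five_le_card_word (hd : 5 ≤ d) (n : ℕ) : 5 ≤ Fintype.card (Word d (n + 1)) := by
  rw [Fintype.card_fun, Fintype.card_fin, Fintype.card_fin]
  exact hd.trans (Nat.le_self_pow (Nat.succ_ne_zero n) d)

theorem isSimpleGroup_factor (hd : 5 ≤ d) (n : ℕ) : IsSimpleGroup (Factor d n) :=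
  alternatingGroup.isSimpleGroup (by simpa using five_le_card_word hd n)

theorem five_le_card_spine (hd : 5 ≤ d) (hr : 2 ≤ r) :
    5 ≤ Fintype.card ({x : Fin d // (x : ℕ) < r} × Fin d) := by
  have : Nonempty {x : Fin d // (x : ℕ) < r} := ⟨⟨⟨0, by omega⟩, by simp; omega⟩⟩
  rw [Fintype.card_prod, Fintype.card_fin]
  exact hd.trans (Nat.le_mul_of_pos_left d Fintype.card_pos)

theorem commutator_B (hd : 5 ≤ d) (hr : 2 ≤ r) : commutator (B d r) = ⊤ :=
  commutator_alternatingGroup_eq_top (by simpa using five_le_card_spine hd hr)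

theorem card_factor_lt (hd : 5 ≤ d) (n : ℕ) :
    Nat.card (Factor d n) < Nat.card (Factor d (n + 1)) := by
  have h : ∀ m, 2 * Nat.card (Factor d m) = (d ^ (m + 1)).factorial := by
    intro m
    have : Nontrivial (Word d (m + 1)) := by
      rw [← Fintype.one_lt_card_iff_nontrivial]
      have := five_le_card_word hd m
      omega
    rw [two_mul_nat_card_alternatingGroup, Nat.card_perm, Nat.card_eq_fintype_card,
      Fintype.card_fun, Fintype.card_fin, Fintype.card_fin]
  have h1 : (d ^ (n + 1)).factorial < (d ^ (n + 1 + 1)).factorial :=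
    (Nat.factorial_lt (by positivity)).2 (Nat.pow_lt_pow_right (by omega) (by omega))
  have := h n
  have := h (n + 1)
  omega

/-- There is an even permutation that moves `x_d ^ (n + 1)` and fixes all `x_d ^ n x` with one of
the first `r` letters `x`. -/
theorem exists_fixing_spineStem (hr : r + 3 ≤ d) (n : ℕ) : ∃ σ : Factor d n,
    (∀ v ∈ spineStem d r n, (σ : Perm (Word d (n + 1))) v = v) ∧
    (σ : Perm (Word d (n + 1))) (corner (show r < d by omega) n) ≠
      corner (show r < d by omega) n := by
  set o := corner (show r < d by omega) n with ho
  -- The bound on r provides two last letters, of indices r and r + 1, outside the first r and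
  -- different from x_d: enough for an even permutation.
  set v : Word d (n + 1) := Function.update o (Fin.last n) ⟨r, by omega⟩ with hv
  set w : Word d (n + 1) := Function.update o (Fin.last n) ⟨r + 1, by omega⟩ with hw
  have hov : o ≠ v := fun h => by
    have := congrArg Fin.val (congrFun h (Fin.last n))
    simp [hv, ho, corner] at this
    omega
  have how : o ≠ w := fun h => by
    have := congrArg Fin.val (congrFun h (Fin.last n))
    simp [hw, ho, corner] at this
    omega
  have hvw : v ≠ w := fun h => by
    have := congrArg Fin.val (congrFun h (Fin.last n))
    simp [hv, hw] at this
  refine ⟨⟨triCycle o v w, (isThreeCycle_triCycle hov how hvw).mem_alternatingGroup⟩,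
    fun x hx => ?_, ?_⟩
  · have hlt := (hx (Fin.last n)).2 rfl
    refine triCycle_apply_of_ne ?_ ?_ ?_ <;> rintro rfl
    · simp [ho, corner] at hlt
      omega
    · simp [hv] at hlt
    · simp [hw] at hlt
  · change triCycle o v w o ≠ o
    rw [triCycle_apply_left hov how]
    exact hov.symm

/-- The alternating group on words of length `n + 2` is generated by the conjugates of `φ(B)`
under the permutations of the prefixes of length `n + 1`. -/
theorem eq_top_of_phi_mem (hd : 5 ≤ d) (hr : 2 ≤ r) {n : ℕ}
    {L : Subgroup (Factor d (n + 1))} (h1 : ∀ b : B d r, phi d r n b ∈ L)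
    (h2 : ∀ σ g, g ∈ L → lift n σ * g * (lift n σ)⁻¹ ∈ L) : L = ⊤ := by
  set x₀ : {x : Fin d // (x : ℕ) < r} := ⟨⟨0, by omega⟩, by simp; omega⟩ with hx₀
  set x₁ : {x : Fin d // (x : ℕ) < r} := ⟨⟨1, by omega⟩, by simp; omega⟩ with hx₁
  have h01 : x₀ ≠ x₁ := by simp [hx₀, hx₁]
  set stem : {x : Fin d // (x : ℕ) < r} → Word d (n + 1) := fun x =>
    Fin.snoc (α := fun _ => Fin d) (fun _ => ⟨d - 1, by omega⟩) x.1 with hstem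
  have hstem_inj : Function.Injective stem := fun x y h =>
    Subtype.ext (Fin.snoc_injective2 h).2
  have hspine : ∀ p, spine d r n p = Fin.snoc (α := fun _ => Fin d) (stem p.1) p.2 :=
    fun p => rfl
  suffices h : alternatingGroup (Word d (n + 1 + 1)) ≤ L.map (Subgroup.subtype _) by
    rw [eq_top_iff]
    intro g _
    obtain ⟨g', hg', he⟩ := h g.2
    rwa [← Subtype.ext he]
  refine alternatingGroup_le_of_exists_triCycle fun a b hab x y => ?_
  -- Two distinct prefixes covering those of a and b; since r ≥ 2, two stems of the spine can be
  -- moved onto them.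
  obtain ⟨ya, yb, hne, hya, hyb⟩ : ∃ ya yb : Word d (n + 1), ya ≠ yb ∧ Fin.init a = ya ∧
      (Fin.init b = ya ∨ Fin.init b = yb) := by
    by_cases h : (Fin.init a : Word d (n + 1)) = Fin.init b
    · have : Nontrivial (Word d (n + 1)) := by
        rw [← Fintype.one_lt_card_iff_nontrivial]
        have := five_le_card_word hd n
        omega
      obtain ⟨z, hz⟩ := exists_ne (Fin.init a : Word d (n + 1))
      exact ⟨_, z, hz.symm, rfl, Or.inl h.symm⟩
    · exact ⟨_, _, h, rfl, Or.inr rfl⟩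
  obtain ⟨σ, hσ⟩ := exists_alternating_extending (ι := Bool) (α := Word d (n + 1))
    ⟨fun t => if t then stem x₀ else stem x₁, by
      intro s t hst
      cases s <;> cases t <;> simp_all⟩
    ⟨fun t => if t then ya else yb, by
      intro s t hst
      cases s <;> cases t <;> simp_all⟩
    (by have := five_le_card_word hd n; simp only [Fintype.card_bool]; omega)
  have hσa : (σ : Perm (Word d (n + 1))) (stem x₀) = ya := hσ true
  have hσb : (σ : Perm (Word d (n + 1))) (stem x₁) = yb := hσ false
  set J : {x : Fin d // (x : ℕ) < r} × Fin d → Word d (n + 1 + 1) := fun p =>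
    (lift n σ : Perm (Word d (n + 1 + 1))) (spine d r n p) with hJ
  have hJinj : Function.Injective J := (Equiv.injective _).comp (spine d r n).injective
  have hJa : ∀ t, J (x₀, t) = Fin.snoc (α := fun _ => Fin d) ya t := fun t => by
    rw [hJ, ← hσa]; exact iota_snoc σ _ _
  have hJb : ∀ t, J (x₁, t) = Fin.snoc (α := fun _ => Fin d) yb t := fun t => by
    rw [hJ, ← hσb]; exact iota_snoc σ _ _
  have hJtri : ∀ p q s, p ≠ q → p ≠ s → q ≠ s →
      triCycle (J p) (J q) (J s) ∈ L.map (Subgroup.subtype _) := by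
    intro p q s hpq hps hqs
    set b : B d r := ⟨triCycle p q s, (isThreeCycle_triCycle hpq hps hqs).mem_alternatingGroup⟩
    refine ⟨_, h2 σ _ (h1 b), ?_⟩
    have : (phi d r n b : Perm (Word d (n + 1 + 1))) =
        triCycle (spine d r n p) (spine d r n q) (spine d r n s) :=
      viaEmbeddingHom_triCycle _ _ _ _
    simp only [map_mul, map_inv, Subgroup.coe_subtype]
    rw [this, conj_triCycle]
  obtain ⟨p, rfl⟩ : ∃ p, J p = a := ⟨(x₀, a (Fin.last _)), by
    rw [hJa, ← hya]; exact Fin.snoc_init_self a⟩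
  obtain ⟨q, rfl⟩ : ∃ q, J q = b := by
    rcases hyb with h | h
    · exact ⟨(x₀, b (Fin.last _)), by rw [hJa, ← h]; exact Fin.snoc_init_self b⟩
    · exact ⟨(x₁, b (Fin.last _)), by rw [hJb, ← h]; exact Fin.snoc_init_self b⟩
  -- The image of J has at least five points, so one avoids these four.
  have hcard : ({J p, J q, x, y} : Finset (Word d (n + 1 + 1))).card ≤ 4 := Finset.card_le_four
  obtain ⟨c, hc, hc'⟩ : ∃ c ∈ Finset.univ.map ⟨J, hJinj⟩,
      c ∉ ({J p, J q, x, y} : Finset (Word d (n + 1 + 1))) := by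
    refine Finset.exists_mem_notMem_of_card_lt_card (lt_of_le_of_lt hcard ?_)
    rw [Finset.card_map, Finset.card_univ]
    have := five_le_card_spine hd hr
    omega
  obtain ⟨s, -, rfl⟩ := Finset.mem_map.1 hc
  simp only [Function.Embedding.coeFn_mk, Finset.mem_insert, Finset.mem_singleton, not_or] at hc' ⊢
  refine ⟨J s, hc'.1, hc'.2.1, hc'.2.2.1, hc'.2.2.2, hJtri p q s ?_ ?_ ?_⟩
  · rintro rfl; exact hab rfl
  · rintro rfl; exact hc'.1 rfl
  · rintro rfl; exact hc'.2.1 rfl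

/-- The truncation of a sequence to the indices from `m` on. -/
def truncate (d m : ℕ) : Seqs d →* Seqs d where
  toFun g k := if m ≤ k then g k else 1
  map_one' := by funext k; simp
  map_mul' g g' := by funext k; by_cases h : m ≤ k <;> simp [h]

theorem truncate_apply_of_le {m k : ℕ} (h : m ≤ k) (g : Seqs d) : truncate d m g k = g k := by
  simp [truncate, h]

theorem truncate_apply_of_lt {m k : ℕ} (h : k < m) (g : Seqs d) : truncate d m g k = 1 := by
  simp [truncate, Nat.not_le.2 h]

theorem truncate_zero (g : Seqs d) : truncate d 0 g = g := by
  funext k; exact truncate_apply_of_le (Nat.zero_le k) g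

theorem truncate_truncate {m m' : ℕ} (h : m ≤ m') (g : Seqs d) :
    truncate d m' (truncate d m g) = truncate d m' g := by
  funext k
  rcases Nat.lt_or_ge k m' with hk | hk
  · rw [truncate_apply_of_lt hk, truncate_apply_of_lt hk]
  · rw [truncate_apply_of_le hk, truncate_apply_of_le hk, truncate_apply_of_le (h.trans hk)]

theorem truncate_eq_self {m : ℕ} {g : Seqs d} (h : ∀ k < m, g k = 1) : truncate d m g = g := by
  funext k
  rcases Nat.lt_or_ge k m with hk | hk
  · rw [truncate_apply_of_lt hk, h k hk]
  · rw [truncate_apply_of_le hk]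

theorem truncate_eq_mulSingle_mul (m : ℕ) (g : Seqs d) :
    truncate d m g = Pi.mulSingle m (g m) * truncate d (m + 1) g := by
  funext k
  rw [Pi.mul_apply]
  rcases lt_trichotomy k m with h | rfl | h
  · rw [truncate_apply_of_lt h, truncate_apply_of_lt (by omega), Pi.mulSingle_eq_of_ne h.ne,
      mul_one]
  · rw [truncate_apply_of_le le_rfl, truncate_apply_of_lt (by omega), Pi.mulSingle_eq_same,
      mul_one]
  · rw [truncate_apply_of_le h.le, truncate_apply_of_le h, Pi.mulSingle_eq_of_ne h.ne', one_mul]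

/-- The group generated by the sequences `delta n σ` and `tail n b`. -/
def tailGroup (hr : r < d) (n : ℕ) : Subgroup (Seqs d) :=
  Subgroup.closure (Set.range (delta n) ∪ Set.range (tail hr n))

theorem telescopeGroup_eq_tailGroup (hr : r < d) : telescopeGroup d r = tailGroup hr 0 := by
  have h1 : deltaOne d = delta 0 := funext deltaOne_eq_delta
  have h2 : tilde d r = tail hr 0 := funext (tilde_eq_tail hr)
  rw [telescopeGroup, tailGroup, h1, h2]

theorem delta_mem_tailGroup (hr : r < d) (n : ℕ) (σ : Factor d n) : delta n σ ∈ tailGroup hr n :=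
  Subgroup.subset_closure (Or.inl ⟨σ, rfl⟩)

theorem tail_mem_tailGroup (hr : r < d) (n : ℕ) (b : B d r) : tail hr n b ∈ tailGroup hr n :=
  Subgroup.subset_closure (Or.inr ⟨b, rfl⟩)

theorem apply_eq_one_of_mem_tailGroup (hr : r < d) {n k : ℕ} (hk : k < n) {g : Seqs d}
    (hg : g ∈ tailGroup hr n) : g k = 1 := by
  have : tailGroup hr n ≤ (Pi.evalMonoidHom (Factor d) k).ker := by
    rw [tailGroup, Subgroup.closure_le]
    rintro _ (⟨σ, rfl⟩ | ⟨b, rfl⟩)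
    · exact delta_apply_of_lt hk σ
    · exact tail_apply_of_le hr hk.le b
  exact this hg

/-- Commutators of tails give the heads of all commutators in B, hence of all of B by perfectness.
Conjugation by `delta n` acts as conjugation by lifted permutations, and such conjugates of the
heads generate. -/
theorem delta_succ_mem_tailGroup (hd : 5 ≤ d) (hr2 : 2 ≤ r) (hrd : r + 3 ≤ d) (hr : r < d) (n : ℕ)
    (ρ : Factor d (n + 1)) : delta (n + 1) ρ ∈ tailGroup hr n := by
  have : (tailGroup hr n).comap (delta (n + 1)) = ⊤ := by
    refine eq_top_of_phi_mem hd hr2 (fun b => ?_) fun σ g hg => ?_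
    · have : commutator (B d r) ≤
          ((tailGroup hr n).comap (delta (n + 1))).comap (phi d r n) := by
        rw [commutator_def, Subgroup.commutator_le]
        intro b _ b' _
        obtain ⟨σ, hσ, ho⟩ := exists_fixing_spineStem hrd n
        rw [Subgroup.mem_comap, Subgroup.mem_comap, ← commutator_delta_conj_tail hr hσ ho]
        have hδ := delta_mem_tailGroup hr n σ
        have h1 := mul_mem (mul_mem hδ (tail_mem_tailGroup hr n b)) (inv_mem hδ)
        have h2 := tail_mem_tailGroup hr n b'
        exact mul_mem (mul_mem (mul_mem h1 h2) (inv_mem h1)) (inv_mem h2)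
      exact this (commutator_B hd hr2 ▸ Subgroup.mem_top b)
    · rw [Subgroup.mem_comap, ← delta_conj_delta]
      have hδ := delta_mem_tailGroup hr n σ
      exact mul_mem (mul_mem hδ hg) (inv_mem hδ)
  have h : ρ ∈ (tailGroup hr n).comap (delta (n + 1)) := this ▸ Subgroup.mem_top ρ
  exact h

theorem tailGroup_succ_le (hd : 5 ≤ d) (hr2 : 2 ≤ r) (hrd : r + 3 ≤ d) (hr : r < d) (n : ℕ) :
    tailGroup hr (n + 1) ≤ tailGroup hr n := by
  have h := delta_succ_mem_tailGroup hd hr2 hrd hr n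
  rw [tailGroup, Subgroup.closure_le]
  rintro _ (⟨σ, rfl⟩ | ⟨b, rfl⟩)
  · exact h σ
  · have := tail_eq_delta_mul hr n b
    rw [← inv_mul_eq_iff_eq_mul] at this
    rw [← this]
    exact mul_mem (inv_mem (h _)) (tail_mem_tailGroup hr n b)

theorem tailGroup_antitone (hd : 5 ≤ d) (hr2 : 2 ≤ r) (hrd : r + 3 ≤ d) (hr : r < d) :
    Antitone (tailGroup hr) :=
  antitone_nat_of_succ_le (tailGroup_succ_le hd hr2 hrd hr)

theorem mulSingle_mem_tailGroup (hd : 5 ≤ d) (hr2 : 2 ≤ r) (hrd : r + 3 ≤ d) (hr : r < d)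
    {n m : ℕ} (hm : n ≤ m) (σ : Factor d m) : Pi.mulSingle m σ ∈ tailGroup hr n := by
  refine tailGroup_antitone hd hr2 hrd hr hm ?_
  have := delta_eq_mulSingle_mul m σ
  rw [← mul_inv_eq_iff_eq_mul] at this
  rw [← this]
  exact mul_mem (delta_mem_tailGroup hr m σ)
    (inv_mem (delta_succ_mem_tailGroup hd hr2 hrd hr m _))

theorem directSum_le (hd : 5 ≤ d) (hr2 : 2 ≤ r) (hrd : r + 3 ≤ d) (hr : r < d) {g : Seqs d}
    (hg : {n | g n ≠ 1}.Finite) : g ∈ tailGroup hr 0 := by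
  classical
  refine Submonoid.pi_mem_of_mulSingle_mem_aux hg.toFinset g (fun i hi => ?_) fun i _ =>
    mulSingle_mem_tailGroup hd hr2 hrd hr (Nat.zero_le i) _
  simpa using hi

theorem truncate_mem_tailGroup (hr : r < d) {n : ℕ} {g : Seqs d} (hg : g ∈ tailGroup hr n) :
    truncate d (n + 1) g ∈ tailGroup hr (n + 1) := by
  have : tailGroup hr n ≤ (tailGroup hr (n + 1)).comap (truncate d (n + 1)) := by
    rw [tailGroup, Subgroup.closure_le]
    rintro _ (⟨σ, rfl⟩ | ⟨b, rfl⟩)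
    · have h : truncate d (n + 1) (delta n σ) = delta (n + 1) (lift n σ) := by
        funext k
        rcases Nat.lt_or_ge k (n + 1) with hk | hk
        · rw [truncate_apply_of_lt hk, delta_apply_of_lt hk]
        · rw [truncate_apply_of_le hk, delta_apply_of_le hk, delta_apply_of_le (by omega), lift,
            iota_iota]
      rw [SetLike.mem_coe, Subgroup.mem_comap, h]
      exact delta_mem_tailGroup hr _ _
    · rw [SetLike.mem_coe, Subgroup.mem_comap,
        truncate_eq_self fun k hk => tail_apply_of_le hr (by omega) b, tail_eq_delta_mul]
      exact mul_mem (delta_mem_tailGroup hr _ _) (tail_mem_tailGroup hr _ _)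
  exact this hg

/-- Truncation sends each tail group into the next and fixes an element that is already trivial
there. -/
theorem mem_tailGroup_of_apply_eq_one (hr : r < d) {n : ℕ} {g : Seqs d} (hg : g ∈ tailGroup hr 0)
    (h : ∀ k < n, g k = 1) : g ∈ tailGroup hr n := by
  induction n with
  | zero => exact hg
  | succ n ih =>
    rw [← truncate_eq_self h]
    exact truncate_mem_tailGroup hr (ih fun k hk => h k (by omega))

theorem monoidHom_factor_eq_one (hd : 5 ≤ d) {n : ℕ} {Q : Type*} [Group Q] [Finite Q]
    (hQ : Nat.card Q < Nat.card (Factor d n)) (f : Factor d n →* Q) (σ : Factor d n) :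
    f σ = 1 := by
  have := isSimpleGroup_factor hd n
  rcases (f.normal_ker).eq_bot_or_eq_top with h | h
  · exact absurd (Nat.card_le_card_of_injective f ((MonoidHom.ker_eq_bot_iff f).1 h)) (by omega)
  · have : σ ∈ f.ker := h ▸ Subgroup.mem_top σ
    exact this

/-- The tail group has no non-trivial homomorphism to a finite group that is smaller than its
first factor. -/
theorem monoidHom_tailGroup_eq_one (hd : 5 ≤ d) (hr2 : 2 ≤ r) (hrd : r + 3 ≤ d) (hr : r < d)
    {n : ℕ} {Q : Type*} [Group Q] [Finite Q] (hQ : Nat.card Q < Nat.card (Factor d n))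
    (f : tailGroup hr n →* Q) (g : tailGroup hr n) : f g = 1 := by
  set D : Factor d n →* tailGroup hr n :=
    (delta n).codRestrict _ (delta_mem_tailGroup hr n) with hD
  set D' : Factor d (n + 1) →* tailGroup hr n :=
    (delta (n + 1)).codRestrict _ (delta_succ_mem_tailGroup hd hr2 hrd hr n) with hD'
  set T : B d r →* tailGroup hr n := (tail hr n).codRestrict _ (tail_mem_tailGroup hr n) with hT
  have h1 : ∀ σ, f (D σ) = 1 := monoidHom_factor_eq_one hd hQ (f.comp D)
  have h2 : ∀ σ, f (D' σ) = 1 :=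
    monoidHom_factor_eq_one hd (hQ.trans (card_factor_lt hd n)) (f.comp D')
  -- Once f kills `D` and `D'`, the commutator identity says that f(T b) and f(T b') commute.
  have h3 : ∀ b, f (T b) = 1 := by
    refine monoidHom_eq_one_of_commute (commutator_B hd hr2) (f.comp T) fun b b' => ?_
    obtain ⟨σ, hσ, ho⟩ := exists_fixing_spineStem hrd n
    have : ⁅D σ * T b * (D σ)⁻¹, T b'⁆ = D' (phi d r n ⁅b, b'⁆) :=
      Subtype.ext (commutator_delta_conj_tail hr hσ ho b b')
    have := congrArg f this
    rw [h2, map_commutatorElement, map_mul, map_mul, map_inv, h1, one_mul, inv_one, mul_one,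
      commutatorElement_eq_one_iff_commute] at this
    exact this
  have hle : tailGroup hr n ≤ f.ker.map (tailGroup hr n).subtype := by
    conv_lhs => rw [tailGroup]
    rw [Subgroup.closure_le]
    rintro _ (⟨σ, rfl⟩ | ⟨b, rfl⟩)
    · exact ⟨D σ, h1 σ, rfl⟩
    · exact ⟨T b, h3 b, rfl⟩
  obtain ⟨g', hg', he⟩ := hle g.2
  rwa [← Subtype.ext he]

/-- Every normal subgroup of finite index contains all the elements of the tail group that are
trivial below a certain index. -/
theorem exists_forall_mem_of_normal (hd : 5 ≤ d) (hr2 : 2 ≤ r) (hrd : r + 3 ≤ d) (hr : r < d)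
    (N : Subgroup (tailGroup hr 0)) [N.Normal] [N.FiniteIndex] :
    ∃ n, ∀ g : tailGroup hr 0, (∀ k < n, (g : Seqs d) k = 1) → g ∈ N := by
  have hmono : StrictMono fun n => Nat.card (Factor d n) := strictMono_nat_of_lt_succ
    (card_factor_lt hd)
  -- The orders of the factors increase strictly, so the factor at n has order at least n, exceeding
  -- the index of N.
  set n := Nat.card (tailGroup hr 0 ⧸ N) + 1 with hn
  refine ⟨n, fun g hg => ?_⟩
  have hmem := mem_tailGroup_of_apply_eq_one hr g.2 hg
  have hQ : Nat.card (tailGroup hr 0 ⧸ N) < Nat.card (Factor d n) :=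
    lt_of_lt_of_le (Nat.lt_succ_self _) (hmono.id_le n)
  have := monoidHom_tailGroup_eq_one hd hr2 hrd hr hQ ((QuotientGroup.mk' N).comp
    (Subgroup.inclusion (tailGroup_antitone hd hr2 hrd hr (Nat.zero_le n)))) ⟨g, hmem⟩
  exact (QuotientGroup.eq_one_iff g).1 this

end TailGroup

end AltTelescope

/-! ### A criterion for the completion map to be an isomorphism -/

namespace Frame

open CategoryTheory ProfiniteGrp ProfiniteCompletion

variable {S : ℕ → Type} [∀ n, Group (S n)] [∀ n, Finite (S n)]

/-- The map from the profinite completion to the product is an isomorphism if the subgroup contains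
the direct sum and each of its normal subgroups of finite index contains all the elements that are
trivial below a certain index. -/
theorem completion_isIso (G : Subgroup (∀ n, S n))
    (hsum : ∀ g : ∀ n, S n, {n | g n ≠ 1}.Finite → g ∈ G)
    (hN : ∀ N : Subgroup G, N.Normal → N.FiniteIndex →
      ∃ n, ∀ g : G, (∀ k < n, (g : ∀ n, S n) k = 1) → g ∈ N) :
    IsIso (lift (inclusion G)) := by
  let _ : ∀ n, TopologicalSpace (S n) := fun _ => ⊥
  have _ : ∀ n, DiscreteTopology (S n) := fun _ => ⟨rfl⟩
  set F : completion (GrpCat.of G) →* ∀ n, S n := (lift (inclusion G)).hom.toMonoidHom with hF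
  have hFc : Continuous F := (lift (inclusion G)).hom.continuous_toFun
  have hη : ∀ g : G, F (etaFn (GrpCat.of G) g) = g := fun g =>
    ConcreteCategory.congr_hom (lift_eta (inclusion G)) g
  have hinj : Function.Injective F := by
    rw [injective_iff_map_eq_one]
    intro x hx
    by_contra hne
    obtain ⟨U, hU⟩ := exist_openNormalSubgroup_sub_open_nhds_of_one
      (isOpen_compl_singleton (x := x)) (by simpa using Ne.symm hne)
    -- U is an open normal subgroup missing x. The elements of G trivial below some n map into U,
    -- and by density one of them maps into the coset xU, because x lies in the kernel of F. Then x
    -- would lie in U.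
    set N := U.toFiniteIndexNormalSubgroup.comap (eta (GrpCat.of G)).hom with hNdef
    obtain ⟨n, hn⟩ := hN N.toSubgroup inferInstance inferInstance
    have hV : IsOpen {y | ∀ k < n, F y k = 1} := by
      have : {y | ∀ k < n, F y k = 1} = ⋂ k ∈ Finset.range n, (fun y => F y k) ⁻¹' {1} := by
        ext y; simp
      rw [this]
      exact isOpen_biInter_finset fun k _ =>
        (isOpen_discrete _).preimage ((continuous_apply k).comp hFc)
    have hW : IsOpen {y | x⁻¹ * y ∈ U} := U.isOpen'.preimage (continuous_const_mul x⁻¹)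
    obtain ⟨g, hgV, hgW⟩ := (denseRange (G := GrpCat.of G)).exists_mem_open (hV.inter hW)
      ⟨x, by simp [hx], by simp⟩
    have hgU : etaFn (GrpCat.of G) g ∈ U := hn g fun k hk => by
      have := hgV k hk
      rwa [hη] at this
    have hxU : x ∈ U := by
      have h1 : x ∈ U.toOpenSubgroup := by simpa using U.mul_mem hgU (U.inv_mem hgW)
      exact h1
    exact hU hxU rfl
  have hsurj : Function.Surjective F := by
    intro y
    -- The image is closed and contains the direct sum, which is dense in the product.
    have hcl : IsClosed (Set.range F) := (isCompact_range hFc).isClosed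
    have : y ∈ closure (Set.range F) := by
      rw [mem_closure_iff]
      intro o ho hy
      obtain ⟨I, u, hu, hsub⟩ := isOpen_pi_iff.1 ho y hy
      classical
      set g : ∀ n, S n := fun n => if n ∈ I then y n else 1 with hg
      have hgG : g ∈ G := hsum g (I.finite_toSet.subset fun n hn => by
        by_contra hnI
        have hnI' : n ∉ I := hnI
        exact hn (by simp [hg, hnI']))
      refine ⟨g, hsub fun n hn => ?_, etaFn (GrpCat.of G) ⟨g, hgG⟩, hη _⟩
      have hn' : n ∈ I := hn
      simpa [hg, hn'] using (hu n hn').2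
    rwa [hcl.closure_eq] at this
  have : IsIso ((forget ProfiniteGrp).map (lift (inclusion G))) :=
    (isIso_iff_bijective _).2 ⟨hinj, hsurj⟩
  exact isIso_of_reflects_iso _ (forget ProfiniteGrp)

end Frame

namespace AltTelescope

open Equiv Equiv.Perm
open scoped commutatorElement

/-! ### Goursat's lemma for the chain of tail groups -/

section Goursat

variable {d r : ℕ}

theorem truncate_mem_tailGroup_of_mem_zero (hr : r < d) (n : ℕ) {g : Seqs d}
    (hg : g ∈ tailGroup hr 0) : truncate d n g ∈ tailGroup hr n := by
  induction n with
  | zero => rwa [truncate_zero]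
  | succ n ih =>
    rw [← truncate_truncate (Nat.le_succ n)]
    exact truncate_mem_tailGroup hr ih

/-- A form of Goursat's lemma: a subgroup that projects onto the factor with index `k`, and whose
truncation at `k + 1` is the whole tail group, has the whole tail group as truncation at `k`. -/
theorem tailGroup_le_map_truncate (hd : 5 ≤ d) (hr2 : 2 ≤ r) (hrd : r + 3 ≤ d) (hr : r < d)
    {K : Subgroup (Seqs d)} (hK : K ≤ tailGroup hr 0) {k : ℕ}
    (hproj : ∀ ρ : Factor d k, ∃ g ∈ K, g k = ρ)
    (h : tailGroup hr (k + 1) ≤ K.map (truncate d (k + 1))) :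
    tailGroup hr k ≤ K.map (truncate d k) := by
  set M := K.map (truncate d k) with hM
  have hMtr : ∀ m ∈ M, truncate d k m = m := by
    rintro _ ⟨g, -, rfl⟩
    exact truncate_truncate le_rfl g
  have hMsucc : ∀ m ∈ M, truncate d (k + 1) m ∈ tailGroup hr (k + 1) := by
    rintro _ ⟨g, hg, rfl⟩
    rw [truncate_truncate (Nat.le_succ k)]
    exact truncate_mem_tailGroup_of_mem_zero hr _ (hK hg)
  have hMsurj : ∀ g ∈ tailGroup hr (k + 1), ∃ m ∈ M, truncate d (k + 1) m = g := by
    intro g hg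
    obtain ⟨g', hg', rfl⟩ := h hg
    exact ⟨truncate d k g', ⟨g', hg', rfl⟩, truncate_truncate (Nat.le_succ k) g'⟩
  have hMproj : ∀ ρ : Factor d k, ∃ m ∈ M, m k = ρ := by
    intro ρ
    obtain ⟨g, hg, rfl⟩ := hproj ρ
    exact ⟨truncate d k g, ⟨g, hg, rfl⟩, truncate_apply_of_le le_rfl g⟩
  -- N is the part of M concentrated in coordinate k. It is normal because M projects onto that
  -- simple factor, so it is trivial or everything.
  set N : Subgroup (Factor d k) := M.comap (MonoidHom.mulSingle (Factor d) k) with hN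
  have hNn : N.Normal := by
    refine ⟨fun ρ hρ σ => ?_⟩
    obtain ⟨m, hm, rfl⟩ := hMproj σ
    have : MonoidHom.mulSingle (Factor d) k (m k * ρ * (m k)⁻¹) =
        m * MonoidHom.mulSingle (Factor d) k ρ * m⁻¹ := by
      funext j
      simp only [MonoidHom.mulSingle_apply, Pi.mul_apply, Pi.inv_apply]
      rcases eq_or_ne j k with rfl | hj
      · simp
      · simp [Pi.mulSingle_eq_of_ne hj]
    rw [hN, Subgroup.mem_comap, this]
    exact mul_mem (mul_mem hm hρ) (inv_mem hm)
  have hsimple := isSimpleGroup_factor hd k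
  rcases hNn.eq_bot_or_eq_top with hbot | htop
  · exfalso
    -- With N trivial, M is the graph of a surjection from the tail group at k + 1 onto the factor
    -- at k. But that tail group has no nontrivial homomorphism to a group smaller than its own
    -- first factor.
    set π : M →* tailGroup hr (k + 1) :=
      ((truncate d (k + 1)).comp M.subtype).codRestrict _ fun m => hMsucc m m.2 with hπ
    have hπinj : Function.Injective π := by
      rw [injective_iff_map_eq_one]
      rintro ⟨m, hm⟩ hm1
      have h1 : truncate d (k + 1) m = 1 := congrArg Subtype.val hm1
      have h2 := truncate_eq_mulSingle_mul k m
      rw [hMtr m hm, h1, mul_one] at h2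
      have h3 : m k ∈ N := by
        rw [hN, Subgroup.mem_comap, MonoidHom.mulSingle_apply, ← h2]
        exact hm
      rw [hbot, Subgroup.mem_bot] at h3
      rw [h3, Pi.mulSingle_one] at h2
      exact Subtype.ext h2
    have hπsurj : Function.Surjective π := by
      rintro ⟨g, hg⟩
      obtain ⟨m, hm, he⟩ := hMsurj g hg
      exact ⟨⟨m, hm⟩, Subtype.ext he⟩
    set e := MulEquiv.ofBijective π ⟨hπinj, hπsurj⟩ with he
    set f : tailGroup hr (k + 1) →* Factor d k :=
      ((Pi.evalMonoidHom (Factor d) k).comp M.subtype).comp e.symm.toMonoidHom with hf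
    obtain ⟨ρ, hρ⟩ := exists_ne (1 : Factor d k)
    obtain ⟨m, hm, rfl⟩ := hMproj ρ
    have := monoidHom_tailGroup_eq_one hd hr2 hrd hr (card_factor_lt hd k) f (e ⟨m, hm⟩)
    apply hρ
    simpa [hf] using this
  · intro g hg
    -- An element of M agreeing with g beyond k can be corrected in coordinate k, since M contains
    -- that whole factor.
    obtain ⟨m, hm, he⟩ := hMsurj _ (truncate_mem_tailGroup hr hg)
    have h1 : truncate d k g = g :=
      truncate_eq_self fun j hj => apply_eq_one_of_mem_tailGroup hr hj hg
    have h2 : g * m⁻¹ = Pi.mulSingle k (g k * (m k)⁻¹) := by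
      have e1 := h1.symm.trans (truncate_eq_mulSingle_mul k g)
      have e2 := (hMtr m hm).symm.trans (truncate_eq_mulSingle_mul k m)
      calc g * m⁻¹ = Pi.mulSingle k (g k) * truncate d (k + 1) g *
            (Pi.mulSingle k (m k) * truncate d (k + 1) g)⁻¹ := by rw [← e1, ← he, ← e2]
        _ = _ := by rw [Pi.mulSingle_mul, Pi.mulSingle_inv]; group
    have h3 : g * m⁻¹ ∈ M := by
      rw [h2]
      have : g k * (m k)⁻¹ ∈ N := htop ▸ Subgroup.mem_top _
      exact this
    simpa using mul_mem h3 hm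

/-- A subgroup that projects onto the first `n` factors and whose truncation at `n` is the whole
tail group is the whole group. -/
theorem tailGroup_zero_le (hd : 5 ≤ d) (hr2 : 2 ≤ r) (hrd : r + 3 ≤ d) (hr : r < d)
    {K : Subgroup (Seqs d)} (hK : K ≤ tailGroup hr 0) {n : ℕ}
    (hproj : ∀ k < n, ∀ ρ : Factor d k, ∃ g ∈ K, g k = ρ)
    (h : tailGroup hr n ≤ K.map (truncate d n)) : tailGroup hr 0 ≤ K := by
  induction n with
  | zero =>
    intro g hg
    obtain ⟨g', hg', rfl⟩ := h hg
    rwa [truncate_zero]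
  | succ n ih =>
    exact ih (fun k hk => hproj k (by omega))
      (tailGroup_le_map_truncate hd hr2 hrd hr hK (hproj n (Nat.lt_succ_self n)) h)

end Goursat

/-! ### Generation by two elements -/

section TwoGenerators

variable {d r : ℕ}

/-- The support, at the level of prefixes of length `n + 1`, of the tail elements. -/
abbrev tailSupport (hr : r < d) (n : ℕ) : Set (Word d (n + 1)) :=
  insert (corner hr n) (spineStem d r n)

/-- All letters but the last are x_d. The bound is independent of n while the number of words grows,
which makes room for many disjoint copies of the support. -/
theorem card_tailSupport_le (hr : r < d) (n : ℕ) : Nat.card (tailSupport hr n) ≤ d := by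
  have h : Function.Injective fun v : tailSupport hr n => v.1 (Fin.last n) := by
    have hv : ∀ v ∈ tailSupport hr n, ∀ i : Fin (n + 1), (i : ℕ) < n → (v i : ℕ) = d - 1 := by
      rintro v (rfl | hv) i hi
      · rfl
      · exact (hv i).1 hi
    rintro ⟨v, hv1⟩ ⟨w, hw1⟩ hvw
    refine Subtype.ext (funext fun i => ?_)
    refine Fin.lastCases hvw (fun i => Fin.ext ?_) i
    change ((v i.castSucc : Fin d) : ℕ) = w i.castSucc
    rw [hv v hv1 _ (by simp), hv w hw1 _ (by simp)]
  simpa using Nat.card_le_card_of_injective _ h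

/-- The conjugate of the homomorphism `tail` by the sequence of a permutation. -/
noncomputable def conjTail (hr : r < d) {n : ℕ} (s : Factor d n) : B d r →* Seqs d :=
  (MulAut.conj (delta n s)).toMonoidHom.comp (tail hr n)

theorem conjTail_apply (hr : r < d) {n : ℕ} (s : Factor d n) (b : B d r) :
    conjTail hr s b = delta n s * tail hr n b * (delta n s)⁻¹ := rfl

theorem conjTail_mem_supported (hr : r < d) {n : ℕ} (s : Factor d n) (b : B d r) :
    conjTail hr s b ∈ supported n ((s : Perm (Word d (n + 1))) '' tailSupport hr n) :=
  delta_conj_mem_supported s (tail_mem_supported hr n b)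

theorem conjTail_congr (hr : r < d) {n : ℕ} {s t : Factor d n}
    (h : ∀ v ∈ tailSupport hr n, (s : Perm (Word d (n + 1))) v = (t : Perm (Word d (n + 1))) v)
    (b : B d r) : conjTail hr s b = conjTail hr t b :=
  delta_conj_eq_of_eqOn h (tail_mem_supported hr n b)

theorem delta_conj_conjTail (hr : r < d) {n : ℕ} (t s : Factor d n) (b : B d r) :
    delta n t * conjTail hr s b * (delta n t)⁻¹ = conjTail hr (t * s) b := by
  simp only [conjTail_apply, map_mul, mul_inv_rev, mul_assoc]

/-- Homomorphisms with pairwise commuting values combine to a homomorphism of the power. -/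
theorem exists_monoidHom_of_pairwise_commute {ι H G : Type*} [Fintype ι] [DecidableEq ι] [Group H]
    [Group G] (φ : ι → H →* G) (hcomm : Pairwise fun i j => ∀ x y, Commute (φ i x) (φ j y)) :
    ∃ Φ : (ι → H) →* G, (∀ i x, Φ (Pi.mulSingle i x) = φ i x) ∧
      ∀ (x : ι → H) (K : Subgroup G), (∀ i, φ i (x i) ∈ K) → Φ x ∈ K :=
  ⟨MonoidHom.noncommPiCoprod φ hcomm, fun i x => MonoidHom.noncommPiCoprod_mulSingle φ i x,
    fun _ K h => Subgroup.noncommProd_mem K (fun _ _ _ _ hij => hcomm hij _ _) fun i _ => h i⟩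

/-- At a level of sufficiently large index, the tail group is generated by two elements, as soon as
`B` is generated by the commutators of a finite family of involutions: one of the two generators
carries disjointly supported conjugates of all members of the family. -/
theorem exists_tailGroup_le_closure_of_involutions (hd : 5 ≤ d) (hr : r < d) {W : Type*}
    [Fintype W] [DecidableEq W] (β : W → B d r) (hβ : ∀ w, β w ^ 2 = 1)
    (hgen : Subgroup.closure {b | ∃ w w', ⁅β w, β w'⁆ = b} = ⊤) :
    ∃ n, ∃ p ∈ tailGroup hr n, ∃ q ∈ tailGroup hr n,
      tailGroup hr n ≤ Subgroup.closure {p, q} := by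
  classical
  -- Room for two families of copies of the tail support, one copy per w in each; the 5 covers the
  -- three points moved by τ and the two left free when extending to an even permutation.
  obtain ⟨n, hn⟩ : ∃ n, n = 2 * (Fintype.card W * d) + 5 := ⟨_, rfl⟩
  set Z := tailSupport hr n with hZ
  have : Fintype Z := Fintype.ofFinite Z
  have hZd : Fintype.card Z ≤ d := by simpa using card_tailSupport_le hr n
  have hcard : 2 * (Fintype.card W * Fintype.card Z) + 5 ≤ Fintype.card (Word d (n + 1)) := by
    rw [Fintype.card_fun, Fintype.card_fin, Fintype.card_fin]
    have h1 : n + 1 < d ^ (n + 1) := Nat.lt_pow_self (by omega)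
    have h2 := Nat.mul_le_mul_left (Fintype.card W) hZd
    omega
  obtain ⟨σ, τ, hτ3, hστ⟩ := exists_two_generators (five_le_card_word hd n)
  have hfix : Fintype.card {v : Word d (n + 1) // (τ : Perm (Word d (n + 1))) v = v} + 3 =
      Fintype.card (Word d (n + 1)) := by
    rw [Fintype.card_subtype, ← hτ3.card_support, Equiv.Perm.support, ← Finset.card_univ]
    exact Finset.card_filter_add_card_filter_not _
  obtain ⟨E⟩ : Nonempty (Bool × (W × Z) ↪
      {v : Word d (n + 1) // (τ : Perm (Word d (n + 1))) v = v}) := by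
    apply Function.Embedding.nonempty_of_card_le
    rw [Fintype.card_prod, Fintype.card_prod, Fintype.card_bool]
    omega
  -- The blocks `e₀ w` carry the conjugated tails in q₀; the blocks `e₁ w` are empty parking places.
  obtain ⟨e₀, e₁, h00, h11, h01, hfix₀⟩ : ∃ e₀ e₁ : W → Z → Word d (n + 1),
      (∀ {w z w' z'}, e₀ w z = e₀ w' z' → w = w' ∧ z = z') ∧
      (∀ {w z w' z'}, e₁ w z = e₁ w' z' → w = w' ∧ z = z') ∧
      (∀ {w z w' z'}, e₀ w z ≠ e₁ w' z') ∧
      ∀ w z, (τ : Perm (Word d (n + 1))) (e₀ w z) = e₀ w z := by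
    refine ⟨fun w z => (E (false, w, z)).1, fun w z => (E (true, w, z)).1, fun h => ?_,
      fun h => ?_, fun h => ?_, fun w z => (E _).2⟩
    · have h' := E.injective (Subtype.ext h)
      exact ⟨congrArg (fun x => x.2.1) h', congrArg (fun x => x.2.2) h'⟩
    · have h' := E.injective (Subtype.ext h)
      exact ⟨congrArg (fun x => x.2.1) h', congrArg (fun x => x.2.2) h'⟩
    · exact Bool.false_ne_true (congrArg Prod.fst (E.injective (Subtype.ext h)))
  clear E
  have hs : ∀ w : W, ∃ s : Factor d n, ∀ z : Z,
      (s : Perm (Word d (n + 1))) z = e₀ w z := by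
    intro w
    exact exists_alternating_extending (Function.Embedding.subtype _)
      ⟨fun z => e₀ w z, fun z z' h => (h00 h).2⟩
      (by have : 1 ≤ Fintype.card W := Fintype.card_pos_iff.2 ⟨w⟩
          nlinarith)
  choose s hs using hs
  have hsZ : ∀ w, (s w : Perm (Word d (n + 1))) '' Z = {v | ∃ z, v = e₀ w z} := by
    intro w
    ext v
    constructor
    · rintro ⟨z, hz, rfl⟩
      exact ⟨⟨z, hz⟩, hs w ⟨z, hz⟩⟩
    · rintro ⟨z, rfl⟩
      exact ⟨z, z.2, hs w z⟩
  have hmem : ∀ w b, conjTail hr (s w) b ∈ supported n {v | ∃ z, v = e₀ w z} :=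
    fun w b => hsZ w ▸ conjTail_mem_supported hr (s w) b
  have hcomm : Pairwise fun w w' => ∀ b b', Commute (conjTail hr (s w) b)
      (conjTail hr (s w') b') := by
    intro w w' hww' b b'
    refine commute_of_supported (Set.disjoint_left.2 ?_) (hmem w b) (hmem w' b')
    rintro v ⟨z, rfl⟩ ⟨z', h⟩
    exact hww' (h00 h).1
  obtain ⟨Φ, hΦ, hΦmem⟩ := exists_monoidHom_of_pairwise_commute (fun w => conjTail hr (s w)) hcomm
  set q₀ : Seqs d := Φ β with hq₀
  have hq₀2 : q₀ ^ 2 = 1 := by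
    rw [hq₀, ← map_pow, show β ^ 2 = 1 from funext hβ, map_one]
  have hτq : Commute (delta n τ) q₀ := by
    refine delta_commute_of_supported (S := {v | ∃ w z, v = e₀ w z}) ?_ (hΦmem _ _ fun w => ?_)
    · rintro v ⟨w, z, rfl⟩
      exact hfix₀ w z
    · refine supported_mono ?_ (hmem w _)
      rintro v ⟨z, rfl⟩
      exact ⟨_, _, rfl⟩
  have hτ : τ ^ 3 = 1 := by
    apply Subtype.ext
    rw [Subgroup.coe_pow, Subgroup.coe_one, ← hτ3.orderOf, pow_orderOf_eq_one]
  have hconj : ∀ (w : W) b, conjTail hr (s w) b ∈ tailGroup hr n := fun w b =>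
    mul_mem (mul_mem (delta_mem_tailGroup hr n _) (tail_mem_tailGroup hr n b))
      (inv_mem (delta_mem_tailGroup hr n _))
  refine ⟨n, delta n σ, delta_mem_tailGroup hr n σ, delta n τ * q₀,
    mul_mem (delta_mem_tailGroup hr n τ) (hΦmem _ _ fun w => hconj w _), ?_⟩
  set K := Subgroup.closure {delta n σ, delta n τ * q₀} with hK
  have hp : delta n σ ∈ K := Subgroup.subset_closure (by simp)
  have hq : delta n τ * q₀ ∈ K := Subgroup.subset_closure (by simp)
  have hτK : delta n τ ∈ K := by
    -- The commuting factors have orders dividing 3 and 2, and 4 is 1 modulo 3 and 0 modulo 2.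
    have h4 : (delta n τ * q₀) ^ 4 = delta n τ := by
      rw [hτq.mul_pow, ← map_pow, pow_succ τ 3, hτ, one_mul,
        show q₀ ^ 4 = (q₀ ^ 2) ^ 2 by rw [← pow_mul], hq₀2, one_pow, mul_one]
    exact h4 ▸ pow_mem hq 4
  have hq₀K : q₀ ∈ K := by
    have := mul_mem (inv_mem hτK) hq
    rwa [inv_mul_cancel_left] at this
  have hδ : ∀ ρ : Factor d n, delta n ρ ∈ K := by
    have : Subgroup.closure {σ, τ} ≤ K.comap (delta n) := by
      rw [Subgroup.closure_le]
      rintro _ (rfl | rfl)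
      · exact hp
      · exact hτK
    intro ρ
    exact this (hστ ▸ Subgroup.mem_top ρ)
  have hsplit : ∀ w : W, ∃ e ∈ supported n {v | ∃ w' z, w' ≠ w ∧ v = e₀ w' z},
      q₀ = conjTail hr (s w) (β w) * e := by
    intro w
    refine ⟨Φ (Function.update β w 1), hΦmem _ _ fun w' => ?_, ?_⟩
    · rcases eq_or_ne w' w with rfl | hne
      · simp
      · rw [Function.update_of_ne hne]
        refine supported_mono ?_ (hmem w' _)
        rintro v ⟨z, rfl⟩
        exact ⟨w', z, hne, rfl⟩
    · have h1 : β =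
          Pi.mulSingle w (β w) * Function.update β w 1 := by
        funext w'
        rcases eq_or_ne w' w with rfl | hne
        · simp
        · simp [hne]
      have h2 : Φ (Pi.mulSingle w (β w)) = conjTail hr (s w) (β w) :=
        hΦ w (β w)
      rw [hq₀, ← h2, ← map_mul, ← h1]
  have hcommK : ∀ w w' : W, tail hr n ⁅β w, β w'⁆ ∈ K := by
    intro w w'
    -- t moves the block of w onto that of w' and parks all other blocks. The conjugate of q₀ by t
    -- then meets q₀ only in the block of w', so their commutator is the conjugated tail of ⁅β w, β
    -- w'⁆.
    obtain ⟨t, ht⟩ := exists_alternating_extending (ι := W × Z) (α := Word d (n + 1))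
      ⟨fun x => e₀ x.1 x.2, fun x y h => Prod.ext (h00 h).1 (h00 h).2⟩
      ⟨fun x => if x.1 = w then e₀ w' x.2 else e₁ x.1 x.2, by
        rintro ⟨v, z⟩ ⟨v', z'⟩ h
        dsimp only at h
        split_ifs at h with h1 h2 h2
        · exact Prod.ext (h1.trans h2.symm) (h00 h).2
        · exact absurd h h01
        · exact absurd h.symm h01
        · exact Prod.ext (h11 h).1 (h11 h).2⟩
      (by rw [Fintype.card_prod]; omega)
    replace ht : ∀ x : W × Z, (t : Perm (Word d (n + 1))) (e₀ x.1 x.2) =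
        if x.1 = w then e₀ w' x.2 else e₁ x.1 x.2 := ht
    obtain ⟨e, he, hqe⟩ := hsplit w
    obtain ⟨e', he', hqe'⟩ := hsplit w'
    have hD := delta_conj_mem_supported t he
    set D := delta n t * e * (delta n t)⁻¹ with hDdef
    replace hD : D ∈ supported n {v | ∃ w z, v = e₁ w z} := by
      refine supported_mono ?_ hD
      rintro _ ⟨_, ⟨v, z, hv, rfl⟩, rfl⟩
      exact ⟨v, z, (ht (v, z)).trans (if_neg hv)⟩
    have h1 : delta n t * q₀ * (delta n t)⁻¹ = conjTail hr (s w') (β w) * D := by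
      have h2 : conjTail hr (t * s w) (β w) = conjTail hr (s w') (β w) := by
        refine conjTail_congr hr (fun z hz => ?_) _
        have h3 := hs w ⟨z, hz⟩
        have h4 := hs w' ⟨z, hz⟩
        have h5 := ht (w, ⟨z, hz⟩)
        rw [if_pos rfl] at h5
        rw [Subgroup.coe_mul, Perm.mul_apply, h3, h5, h4]
      rw [← h2, ← delta_conj_conjTail, hDdef, hqe]
      group
    have h2 : ⁅delta n t * q₀ * (delta n t)⁻¹, q₀⁆ = conjTail hr (s w') ⁅β w, β w'⁆ := by
      rw [h1, map_commutatorElement]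
      conv_lhs => rw [hqe']
      refine commutator_mul_mul ?_ ?_ ?_
      · refine commute_of_supported (Set.disjoint_left.2 ?_) hD (hmem w' _)
        rintro v ⟨_, _, rfl⟩ ⟨z, h⟩
        exact h01 h.symm
      · refine commute_of_supported (Set.disjoint_left.2 ?_) hD he'
        rintro v ⟨_, _, rfl⟩ ⟨_, z, _, h⟩
        exact h01 h.symm
      · refine commute_of_supported (Set.disjoint_left.2 ?_) (hmem w' _) he'
        rintro v ⟨z, rfl⟩ ⟨v', z', hv', h⟩
        exact hv' (h00 h).1.symm
    have h3 : conjTail hr (s w') ⁅β w, β w'⁆ ∈ K := by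
      rw [← h2]
      have h4 := mul_mem (mul_mem (hδ t) hq₀K) (inv_mem (hδ t))
      exact mul_mem (mul_mem (mul_mem h4 hq₀K) (inv_mem h4)) (inv_mem hq₀K)
    have h4 := mul_mem (mul_mem (inv_mem (hδ (s w'))) h3) (hδ (s w'))
    rw [conjTail_apply] at h4
    simpa [mul_assoc] using h4
  have htail : ∀ b : B d r, tail hr n b ∈ K := by
    have : (⊤ : Subgroup (B d r)) ≤ K.comap (tail hr n) := by
      rw [← hgen, Subgroup.closure_le]
      rintro _ ⟨w, w', rfl⟩
      exact hcommK w w'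
    exact fun b => this (Subgroup.mem_top b)
  conv_lhs => rw [tailGroup]
  rw [Subgroup.closure_le]
  rintro _ (⟨ρ, rfl⟩ | ⟨b, rfl⟩)
  · exact hδ ρ
  · exact htail b

/-- At a level of sufficiently large index, the tail group is generated by two elements. -/
theorem exists_tailGroup_le_closure (hd : 5 ≤ d) (hr2 : 2 ≤ r) (hr : r < d) :
    ∃ n, ∃ p ∈ tailGroup hr n, ∃ q ∈ tailGroup hr n,
      tailGroup hr n ≤ Subgroup.closure {p, q} := by
  refine exists_tailGroup_le_closure_of_involutions hd hr
    (fun w : {w : B d r // w ^ 2 = 1} => w.1) (fun w => w.2) ?_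
  rw [eq_top_iff, ← closure_commutators_involutions (five_le_card_spine hd hr2)]
  refine Subgroup.closure_mono ?_
  rintro _ ⟨w, w', hw, hw', rfl⟩
  exact ⟨⟨w, hw⟩, ⟨w', hw'⟩, rfl⟩

/-- The telescope group is generated by two elements. -/
theorem exists_tailGroup_zero_eq_closure (hd : 5 ≤ d) (hr2 : 2 ≤ r) (hrd : r + 3 ≤ d)
    (hr : r < d) : ∃ p q : Seqs d, tailGroup hr 0 = Subgroup.closure {p, q} := by
  obtain ⟨n, p, hp, q, hq, h⟩ := exists_tailGroup_le_closure hd hr2 hr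
  -- Below n the coordinates of p and q are trivial, so they can be replaced by a generating pair of
  -- each factor without affecting the truncation at n.
  choose σ τ _ hστ using fun k => exists_two_generators (five_le_card_word hd k)
  set ext : (∀ k, Factor d k) → Seqs d → Seqs d := fun ρ g k => if k < n then ρ k else g k
    with hext
  have hext_mem : ∀ ρ, ∀ g ∈ tailGroup hr n, ext ρ g ∈ tailGroup hr 0 := by
    intro ρ g hg
    have h1 : ext ρ g = ext ρ 1 * g := by
      funext k
      rcases Nat.lt_or_ge k n with hk | hk
      · simp [hext, hk, apply_eq_one_of_mem_tailGroup hr hk hg]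
      · simp [hext, Nat.not_lt.2 hk]
    rw [h1]
    refine mul_mem (directSum_le hd hr2 hrd hr ?_)
      (tailGroup_antitone hd hr2 hrd hr (Nat.zero_le n) hg)
    refine (Set.finite_lt_nat n).subset fun k hk => ?_
    by_contra hkn
    have hkn' : ¬ k < n := hkn
    exact hk (by simp [hext, hkn'])
  have hext_tr : ∀ ρ, ∀ g ∈ tailGroup hr n, truncate d n (ext ρ g) = g := by
    intro ρ g hg
    funext k
    rcases Nat.lt_or_ge k n with hk | hk
    · rw [truncate_apply_of_lt hk, apply_eq_one_of_mem_tailGroup hr hk hg]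
    · rw [truncate_apply_of_le hk]
      simp [hext, Nat.not_lt.2 hk]
  have hle : Subgroup.closure {ext σ p, ext τ q} ≤ tailGroup hr 0 := by
    rw [Subgroup.closure_le]
    rintro _ (rfl | rfl)
    · exact hext_mem σ p hp
    · exact hext_mem τ q hq
  refine ⟨ext σ p, ext τ q, le_antisymm (tailGroup_zero_le hd hr2 hrd hr hle (n := n) ?_ ?_) hle⟩
  · intro k hk ρ
    have h1 : (⊤ : Subgroup (Factor d k)) ≤
        (Subgroup.closure {ext σ p, ext τ q}).map (Pi.evalMonoidHom (Factor d) k) := by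
      rw [← hστ k, Subgroup.closure_le]
      rintro _ (rfl | rfl)
      · exact ⟨ext σ p, Subgroup.subset_closure (by simp), by simp [hext, hk]⟩
      · exact ⟨ext τ q, Subgroup.subset_closure (by simp), by simp [hext, hk]⟩
    exact h1 (Subgroup.mem_top ρ)
  · rw [MonoidHom.map_closure, Set.image_pair, hext_tr σ p hp, hext_tr τ q hq]
    exact h

end TwoGenerators

end AltTelescope

theorem theorem1p3 (d r : ℕ) (hd : 5 ≤ d) (hr : 2 ≤ r) (hrd : r ≤ d - 3) :
    (∃ a b : ∀ n, AltTelescope.Factor d n,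
      AltTelescope.telescopeGroup d r = Subgroup.closure {a, b}) ∧
    Frame.IsFrame (AltTelescope.telescopeGroup d r) := by
  have hr3 : r + 3 ≤ d := by omega
  have hlt : r < d := by omega
  rw [AltTelescope.telescopeGroup_eq_tailGroup hlt]
  obtain ⟨p, q, hpq⟩ := AltTelescope.exists_tailGroup_zero_eq_closure hd hr hr3 hlt
  refine ⟨⟨p, q, hpq⟩, ?_, fun g hg => AltTelescope.directSum_le hd hr hr3 hlt hg, ?_⟩
  · exact (Subgroup.fg_iff _).2 ⟨{p, q}, hpq.symm, by simp⟩
  · exact Frame.completion_isIso _ (fun g hg => AltTelescope.directSum_le hd hr hr3 hlt hg)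
      fun N _ _ => AltTelescope.exists_forall_mem_of_normal hd hr hr3 hlt N
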